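/- **Setting.** For $N\ge1$ let $\mathbb Z_N=\mathbb Z\cap(-N/2,N/2]$, with differences $i-j$ taken modulo $N$ in $\mathbb Z_N$. Let $1\le W\le N$ be an integer, and let $[\![1,W]\!]=\{1,\dots,W\}$ be read modulo $N$. Let $f:\mathbb Z_N\to[0,\infty)$ be symmetric with $\sum_{x\in\mathbb Z_N} f(x)=1$ and $$c_sW^{-1}\mathbf 1_{|x|\le W}\le f(x)\le C_sW^{-1}\mathbf 1_{|x|\le C_sW}\qquad(x\in\mathbb Z_N),$$ where $c_s,C_s>0$ are constants. Put $s_{ij}=f(i-j)$ and, for $\zeta\ge0$, $$S_{ij}=(s_\zeta)_{ij}:=s_{ij}-\frac{\zeta(1+\delta_{ij})}{W}\mathbf 1_{i,j\in[\![1,W]\!]} .$$ Let $m_{\rm sc}(z)=\frac{-z+\sqrt{z^2-4}}2$, with the branch for which $\operatorname{Im}m_{\rm sc}(z)>0$ when $\operatorname{Im}z>0$, be the Stieltjes transform of the semicircle law, and write $\|X\|_{\max}=\max_{i,j}|X_{ij}|$. **Assumptions.** Let $\kappa>0$ and $\varepsilon_*,\varepsilon^*$ be constants with $0<\varepsilon^*\le\varepsilon_*/20$.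 Let $e\in\mathbb R$, $z,\widetilde z\in\mathbb C$, $\zeta\in\mathbb R$ and $\mathbf g\in\mathbb R^{\mathbb Z_N}$ satisfy $|e|<2-\kappa$, $$|\operatorname{Re}z-e|\le N^{-\varepsilon_*+3\varepsilon^*},\quad N^{-\varepsilon_*}\le\operatorname{Im}z\le N^{-\varepsilon^*},\quad 0\le\zeta\le N^{-\varepsilon_*+\varepsilon^*},\quad \|\mathbf g\|_\infty\le W^{-3/4},$$ $$\log_NW\ge\max\{\tfrac34+\varepsilon^*,\ \tfrac12+\varepsilon_*+\varepsilon^*\},\qquad \operatorname{Re}\widetilde z=e,\quad 0\le\operatorname{Im}\widetilde z\le\operatorname{Im}z .$$ **Lemma 2.3.** There is a constant $\delta>0$, depending only on $\kappa,c_s,C_s$, and there are constants $C,c>0$ and $N_0$, depending only on $\kappa,c_s,C_s,\varepsilon_*,\varepsilon^*$, such that for all $N\ge N_0$ and all $W,f,e,\zeta,\mathbf g,z,\widetilde z$ as above the following holds. There is exactly one vector $(M_i)_{i\in\mathbb Z_N}$ of non-zero complex numbers with $$M_i^{-1}=-z\mathbf 1_{i\in[\![1,W]\!]}-\widetilde z\mathbf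 1_{i\notin[\![1,W]\!]}-g_i-\sum_j S_{ij}M_j\quad(i\in\mathbb Z_N),\qquad \max_i|M_i-m_{\rm sc}(\widetilde z+\mathrm i0^+)|\le\delta .$$ With $M$ the diagonal matrix with entries $M_i$, the matrices $1-M^2S$ and $1-S|M|^2$ are invertible, $$\big|[(1-M^2S)^{-1}]_{ij}-\delta_{ij}\big|\le CW^{-1}\quad\text{if }|i-j|\le(\log N)^2W,$$ $$\big|[(1-M^2S)^{-1}]_{ij}\big|\le CN^{-c\log N}\quad\text{if }|i-j|>(\log N)^2W,$$ and $$\big\|(1-S|M|^2)^{-1}S\big\|_{\max}\le C\Big(\frac1{W\operatorname{Im}z}+\frac N{W^2}\Big).$$ -/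

import Mathlib

namespace BandMatrix

/-- The absolute value `|x|` of `x ∈ ℤ_N = ℤ ∩ (-N/2, N/2]`; indices live in `ZMod N`, so that
`i - j` is taken modulo `N`, and `valMinAbs` is the representative in `(-N/2, N/2]`. -/
def cabs {N : ℕ} (x : ZMod N) : ℕ := x.valMinAbs.natAbs

/-- The conditions on the variance profile `f`, where `s_{ij} = f (i - j)`:
`f` is non-negative and symmetric, has total mass one, and
`cs W⁻¹ 1_{|x| ≤ W} ≤ f x ≤ Cs W⁻¹ 1_{|x| ≤ Cs W}`. -/
structure IsBandProfile (N W : ℕ) [NeZero N] (cs Cs : ℝ) (f : ZMod N → ℝ) : Prop where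
  nonneg : ∀ x, 0 ≤ f x
  symm : ∀ x, f (-x) = f x
  sum_eq_one : ∑ x, f x = 1
  lower : ∀ x, cs * (W : ℝ)⁻¹ * (if cabs x ≤ W then 1 else 0) ≤ f x
  upper : ∀ x, f x ≤ Cs * (W : ℝ)⁻¹ * (if (cabs x : ℝ) ≤ Cs * W then 1 else 0)

/-- The set of indices `⟦1, W⟧`, as residues modulo `N`. -/
def block (N W : ℕ) : Finset (ZMod N) :=
  (Finset.Icc 1 W).image (fun k : ℕ => (k : ZMod N))

/-- The matrix `S₀` with entries `s_{ij} = f (i - j)`. -/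
def S₀ {N : ℕ} (f : ZMod N → ℝ) : Matrix (ZMod N) (ZMod N) ℝ :=
  Matrix.of fun i j => f (i - j)

/-- The matrix `Σ` with entries `(1 + δ_{ij}) W⁻¹ 1_{i, j ∈ ⟦1, W⟧}`. -/
noncomputable def blockSigma (N W : ℕ) : Matrix (ZMod N) (ZMod N) ℝ :=
  Matrix.of fun i j =>
    if i ∈ block N W ∧ j ∈ block N W then (1 + (if i = j then 1 else 0)) / (W : ℝ) else 0

/-- The matrix of variances `S_ζ = S₀ - ζ Σ`. -/
noncomputable def S {N : ℕ} (W : ℕ) (f : ZMod N → ℝ) (ζ : ℝ) : Matrix (ZMod N) (ZMod N) ℝ :=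
  S₀ f - ζ • blockSigma N W

/-- The Stieltjes transform `m_sc(z) = (-z + √(z² - 4)) / 2` of the semicircle law, with the branch
`√(z² - 4) = √(z - 2) √(z + 2)` (principal roots), which has `Im m_sc > 0` on the upper half plane.
At a real point `x ∈ (-2, 2)` this formula gives the boundary value `m_sc(x + i0⁺)`:
see `tendsto_msc`. -/
noncomputable def msc (z : ℂ) : ℂ :=
  (-z + (z - 2) ^ ((2 : ℂ)⁻¹) * (z + 2) ^ ((2 : ℂ)⁻¹)) / 2

theorem sq_cpow_half (w : ℂ) : (w ^ ((2 : ℂ)⁻¹)) ^ 2 = w := by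
  exact_mod_cast Complex.cpow_nat_inv_pow w (n := 2) (by norm_num)

theorem msc_equation (z : ℂ) : msc z ^ 2 + z * msc z + 1 = 0 := by
  have h1 := sq_cpow_half (z - 2)
  have h2 := sq_cpow_half (z + 2)
  unfold msc
  generalize (z - 2) ^ ((2 : ℂ)⁻¹) = a at *
  generalize (z + 2) ^ ((2 : ℂ)⁻¹) = b at *
  have h3 : (a * b) ^ 2 = z ^ 2 - 4 := by rw [mul_pow, h1, h2]; ring
  linear_combination h3 / 4

theorem cpow_half_mem {w : ℂ} (hw : 0 < w.im) :
    0 < (w ^ ((2 : ℂ)⁻¹)).re ∧ 0 < (w ^ ((2 : ℂ)⁻¹)).im := by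
  have h0 : w ≠ 0 := by rintro rfl; simp at hw
  have hn : 0 < ‖w‖ := norm_pos_iff.mpr h0
  have ha0 : 0 < Complex.arg w := by
    rcases (Complex.arg_nonneg_iff.mpr hw.le).lt_or_eq with h | h
    · exact h
    · exact absurd (Complex.arg_eq_zero_iff.mp h.symm).2 hw.ne'
  have ha1 := Complex.arg_le_pi w
  have e1 : Complex.log w * (2 : ℂ)⁻¹
      = ((Real.log ‖w‖ / 2 : ℝ) : ℂ) + ((Complex.arg w / 2 : ℝ) : ℂ) * Complex.I := by
    apply Complex.ext <;> simp [Complex.log] <;> ring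
  rw [Complex.cpow_def_of_ne_zero h0, e1, Complex.exp_add, ← Complex.ofReal_exp,
    Complex.re_ofReal_mul, Complex.im_ofReal_mul, Complex.exp_ofReal_mul_I_re,
    Complex.exp_ofReal_mul_I_im]
  constructor
  · refine mul_pos (Real.exp_pos _) (Real.cos_pos_of_mem_Ioo ⟨by linarith, ?_⟩)
    have : Complex.arg w ≠ Real.pi := by
      intro h
      exact absurd (Complex.arg_eq_pi_iff.mp h).2 hw.ne'
    have := lt_of_le_of_ne ha1 this
    linarith
  · exact mul_pos (Real.exp_pos _) (Real.sin_pos_of_pos_of_lt_pi (by linarith)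
      (by linarith [Real.pi_pos]))

theorem msc_im_pos {z : ℂ} (hz : 0 < z.im) : 0 < (msc z).im := by
  have h1 := sq_cpow_half (z - 2)
  have h2 := sq_cpow_half (z + 2)
  obtain ⟨ar, ai⟩ := cpow_half_mem (w := z - 2) (by simpa using hz)
  obtain ⟨br, bi⟩ := cpow_half_mem (w := z + 2) (by simpa using hz)
  unfold msc
  generalize (z - 2) ^ ((2 : ℂ)⁻¹) = a at *
  generalize (z + 2) ^ ((2 : ℂ)⁻¹) = b at *
  have hm : (-z + a * b) / 2 = -((b - a) ^ 2) / 4 := by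
    linear_combination (h1 + h2) / 4
  have hp : (b - a) * (b + a) = 4 := by linear_combination h2 - h1
  have hre := congrArg Complex.re hp
  have him := congrArg Complex.im hp
  simp only [Complex.mul_re, Complex.mul_im, Complex.sub_re, Complex.sub_im, Complex.add_re,
    Complex.add_im] at hre him
  norm_num at hre him
  rw [hm]
  have e : (-((b - a) ^ 2) / 4).im = -((b.re - a.re) * (b.im - a.im)) / 2 := by
    have : -((b - a) ^ 2) / 4 = ((1 / 4 : ℝ) : ℂ) * (-((b - a) * (b - a))) := by
      push_cast; ring
    rw [this, Complex.im_ofReal_mul]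
    simp only [Complex.neg_im, Complex.mul_im, Complex.sub_re, Complex.sub_im]
    ring
  rw [e]
  set x := b.re - a.re
  set y := b.im - a.im
  have hP : 0 < b.re + a.re := by linarith
  have hQ : 0 < b.im + a.im := by linarith
  have hx : 0 < x := by
    by_contra hx
    push Not at hx
    have : 0 ≤ y := by
      by_contra hy
      push Not at hy
      nlinarith
    nlinarith
  have hy : y < 0 := by
    by_contra hy
    push Not at hy
    nlinarith
  nlinarith

/-- `msc` attains its boundary values from the upper half plane: `msc z = m_sc(z + i0⁺)`. -/
theorem tendsto_msc {z : ℂ} (hz : 0 ≤ z.im) (h2 : |z.re| < 2) :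
    Filter.Tendsto (fun η : ℝ => msc (z + η * Complex.I)) (nhdsWithin 0 (Set.Ioi 0))
      (nhds (msc z)) := by
  obtain ⟨hl, hr⟩ := abs_lt.mp h2
  have hlin : Filter.Tendsto (fun η : ℝ => z + η * Complex.I) (nhdsWithin 0 (Set.Ioi 0))
      (nhds z) := by
    have : Continuous (fun η : ℝ => z + η * Complex.I) := by fun_prop
    simpa using (this.tendsto 0).mono_left nhdsWithin_le_nhds
  have hA : Filter.Tendsto (fun η : ℝ => (z + η * Complex.I + 2) ^ ((2 : ℂ)⁻¹))
      (nhdsWithin 0 (Set.Ioi 0)) (nhds ((z + 2) ^ ((2 : ℂ)⁻¹))) := by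
    have hs : z + 2 ∈ Complex.slitPlane := Or.inl (by simp; linarith)
    exact (continuousAt_id.cpow continuousAt_const hs).tendsto.comp (hlin.add_const 2)
  have hB : Filter.Tendsto (fun η : ℝ => (z + η * Complex.I - 2) ^ ((2 : ℂ)⁻¹))
      (nhdsWithin 0 (Set.Ioi 0)) (nhds ((z - 2) ^ ((2 : ℂ)⁻¹))) := by
    have hlin' : Filter.Tendsto (fun η : ℝ => z + η * Complex.I - 2) (nhdsWithin 0 (Set.Ioi 0))
      (nhds (z - 2)) := hlin.sub_const 2
    rcases hz.lt_or_eq with hz' | hz'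
    · have hs : z - 2 ∈ Complex.slitPlane := Or.inr (by simpa using hz'.ne')
      exact (continuousAt_id.cpow continuousAt_const hs).tendsto.comp hlin'
    · have hne : z - 2 ≠ 0 := by
        intro h
        have := congrArg Complex.re h
        simp at this
        linarith
      have hlog := Complex.continuousWithinAt_log_of_re_neg_of_im_zero (z := z - 2)
        (by simp; linarith) (by simp [← hz'])
      have hw : Filter.Tendsto (fun η : ℝ => z + η * Complex.I - 2) (nhdsWithin 0 (Set.Ioi 0))
          (nhdsWithin (z - 2) {w : ℂ | 0 ≤ w.im}) := by
        refine tendsto_nhdsWithin_iff.mpr ⟨hlin', ?_⟩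
        filter_upwards [self_mem_nhdsWithin] with η hη
        have : (0 : ℝ) < η := hη
        simp
        linarith
      have hc := hlog.tendsto.comp hw
      have hexp := (Complex.continuous_exp.tendsto _).comp (hc.mul_const ((2 : ℂ)⁻¹))
      rw [Complex.cpow_def_of_ne_zero hne]
      refine hexp.congr' ?_
      filter_upwards [hlin'.eventually_ne hne] with η hη
      simp [Complex.cpow_def_of_ne_zero hη]
  exact ((hlin.neg.add (hB.mul hA)).div_const 2)

/-- `M` solves the self-consistent equations
`M_i⁻¹ = -z 1_{i ∈ ⟦1,W⟧} - z̃ 1_{i ∉ ⟦1,W⟧} - g_i - ∑_j (s_ζ)_{ij} M_j`. -/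
def IsSolution {N : ℕ} [NeZero N] (W : ℕ) (f : ZMod N → ℝ) (ζ : ℝ) (g : ZMod N → ℝ) (z zt : ℂ)
    (M : ZMod N → ℂ) : Prop :=
  ∀ i, M i ≠ 0 ∧
    (M i)⁻¹ = -(if i ∈ block N W then z else zt) - (g i : ℂ) - ∑ j, (S W f ζ i j : ℂ) * M j

/-- The matrix `1 - M² S`, where `M` stands for the diagonal matrix with entries `M_i`. -/
noncomputable def oneSubMsqS {N : ℕ} [NeZero N] (S : Matrix (ZMod N) (ZMod N) ℝ)
    (M : ZMod N → ℂ) : Matrix (ZMod N) (ZMod N) ℂ :=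
  1 - Matrix.diagonal M ^ 2 * S.map Complex.ofReal

/-- The matrix `1 - S |M|²`. -/
noncomputable def oneSubSAbsMsq {N : ℕ} [NeZero N] (S : Matrix (ZMod N) (ZMod N) ℝ)
    (M : ZMod N → ℂ) : Matrix (ZMod N) (ZMod N) ℝ :=
  1 - S * Matrix.diagonal (fun i => ‖M i‖ ^ 2)

/-- The max norm `max_{i,j} |X_{ij}|`. -/
noncomputable def maxNorm {N : ℕ} (X : Matrix (ZMod N) (ZMod N) ℝ) : ℝ :=
  ⨆ p : ZMod N × ZMod N, |X p.1 p.2|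

end BandMatrix

namespace BandMatrix

/-! ### Distances and windows on the cycle -/

section Cyclic

variable {N : ℕ}

/-! The equation is a small perturbation of the translation-invariant one, which is solved by the
constant vector `m = msc zt`. Its linearization there is `1 - m² S₀`, and everything about `M` and
`1 - M² S` follows once this operator is stably invertible in the `∞ → ∞` norm.

Since `|m|` may equal one and `S₀` is stochastic, `B = m² S₀` need not be a contraction. In the
bulk, however, `Im m` is bounded below, so `m²` stays away from `1`. In `(1 + B)² = 1 + m² (2 S₀ +
m² S₀²)` the matrices `S₀` and `S₀²` share mass of order one in each row, and their different phases
make the norm strictly less than `4` (`norm_sq_one_add_smul_le`). Hence the Neumann series in `(1 +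
B) / 2` converges, with bounds independent of `N` (`exists_inverse_one_sub`). The inverse gives
existence and uniqueness of `M` by a contraction argument (`exists_unique_near`). The strict bound
survives the passage from `m² S₀` to `M² S`. Truncating the series gives the decay, because a
polynomial in a band matrix has finite range.

For `1 - S |M|²` no such gap exists. Imaginary parts of the equation give `Im M_i = |M_i|² (Im z_i +
(S Im M)_i)`, where `z_i` is `z` on the block and `zt` off it. Weighting by `Im M` therefore turns
the operator into a symmetric graph Laplacian with killing of order at least `Im z` on the block.
Its Green function is bounded by an energy estimate (`green_bound`): `1/(W Im z)` is the cost of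
being killed in the block, and `N/W²` the resistance of the way to it. -/

theorem cabs_intCast_le [NeZero N] (x : ℤ) : cabs (x : ZMod N) ≤ x.natAbs :=
  ZMod.natAbs_min_of_le_div_two N _ _ (by simp) (ZMod.natAbs_valMinAbs_le _)

theorem cabs_add_le (x y : ZMod N) : cabs (x + y) ≤ cabs x + cabs y :=
  (ZMod.natAbs_valMinAbs_add_le x y).trans (Int.natAbs_add_le _ _)

theorem cabs_sub_le (x y z : ZMod N) : cabs (x - z) ≤ cabs (x - y) + cabs (y - z) := by
  simpa using cabs_add_le (x - y) (y - z)

theorem cabs_add_natCast_sub_le [NeZero N] (a : ZMod N) (x y : ℕ) {L : ℕ} (hx : x ≤ L)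
    (hy : y ≤ L) :
    cabs (a + (x : ZMod N) - (a + (y : ZMod N))) ≤ L := by
  have : a + (x : ZMod N) - (a + (y : ZMod N)) = (((x : ℤ) - y : ℤ) : ZMod N) := by push_cast; ring
  rw [this]
  exact (cabs_intCast_le _).trans (by omega)

theorem add_natCast_injOn (a : ZMod N) {L : ℕ} (hL : L ≤ N) :
    Set.InjOn (fun x : ℕ => a + (x : ZMod N)) (Finset.range L : Set ℕ) := by
  intro x hx y hy h
  simp only [Finset.coe_range, Set.mem_Iio] at hx hy
  have h' : (x : ZMod N) = y := add_left_cancel h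
  rw [ZMod.natCast_eq_natCast_iff'] at h'
  rwa [Nat.mod_eq_of_lt (hx.trans_le hL), Nat.mod_eq_of_lt (hy.trans_le hL)] at h'

theorem sum_range_add_natCast_le [NeZero N] (F : ZMod N → ℝ) (a : ZMod N) {L : ℕ} (hL : L ≤ N)
    (s : Finset (ZMod N)) (hF : ∀ k ∈ s, 0 ≤ F k) (hs : ∀ x < L, a + (x : ZMod N) ∈ s) :
    ∑ x ∈ Finset.range L, F (a + x) ≤ ∑ k ∈ s, F k := by
  rw [← Finset.sum_image (f := F) (g := fun x : ℕ => a + (x : ZMod N))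
    (add_natCast_injOn a hL)]
  refine Finset.sum_le_sum_of_subset_of_nonneg ?_ fun k hk _ => hF k hk
  intro k hk
  obtain ⟨x, hx, rfl⟩ := Finset.mem_image.mp hk
  exact hs x (Finset.mem_range.mp hx)

/-- Powers of a matrix of range `L` have the expected range. -/
theorem pow_apply_eq_zero_of_range [NeZero N] {R : Type*} [Semiring R]
    {X : Matrix (ZMod N) (ZMod N) R} {L : ℝ} (hX : ∀ i j, L < (cabs (i - j) : ℝ) → X i j = 0) (n : ℕ) :
    ∀ i j, (n : ℝ) * L < (cabs (i - j) : ℝ) → (X ^ n) i j = 0 := by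
  induction n with
  | zero =>
    intro i j h
    have : i ≠ j := by rintro rfl; simp [cabs] at h
    simp [this]
  | succ n ih =>
    intro i j h
    rw [pow_succ, Matrix.mul_apply]
    refine Finset.sum_eq_zero fun k _ => ?_
    by_cases hk : (n : ℝ) * L < (cabs (i - k) : ℝ)
    · rw [ih i k hk, zero_mul]
    · rw [hX k j, mul_zero]
      have : (cabs (i - j) : ℝ) ≤ cabs (i - k) + cabs (k - j) := by
        exact_mod_cast cabs_sub_le i k j
      push_cast at h
      linarith

end Cyclic

/-! ### Phase cancellation and inversion in the `∞ → ∞` operator norm -/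

theorem norm_one_add_le {w : ℂ} (hw : ‖w‖ ≤ 1) : ‖1 + w‖ ≤ 2 - ‖1 - w‖ ^ 2 / 4 := by
  have h := parallelogram_law_with_norm ℝ (1 : ℂ) w
  rw [norm_one] at h
  -- The parallelogram law gives `x² ≤ 4 - ‖1 - w‖²` for `x = ‖1 + w‖`, and `x ≤ 1 + x² / 4`
  -- linearizes it.
  nlinarith [norm_nonneg (1 + w), norm_nonneg w, sq_nonneg (‖1 + w‖ - 2)]

/-- The common part `t` of the two masses contributes `t (1 + w)`; only there does the phase of `w`
cause a loss against the triangle inequality. -/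
theorem norm_ofReal_add_mul_ofReal_le {w : ℂ} (hw : ‖w‖ ≤ 1) {a b t : ℝ} (ht : 0 ≤ t)
    (hta : t ≤ a) (htb : t ≤ b) : ‖(a : ℂ) + w * b‖ ≤ a + b - t * (2 - ‖1 + w‖) := by
  have e : (a : ℂ) + w * b = ((a - t : ℝ) : ℂ) + w * ((b - t : ℝ) : ℂ) + (t : ℂ) * (1 + w) := by
    push_cast; ring
  rw [e]
  refine (norm_add₃_le).trans ?_
  rw [norm_mul, norm_mul, Complex.norm_real, Complex.norm_real, Complex.norm_real,
    Real.norm_of_nonneg (sub_nonneg.2 hta), Real.norm_of_nonneg (sub_nonneg.2 htb),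
    Real.norm_of_nonneg ht]
  nlinarith [mul_le_mul_of_nonneg_right hw (sub_nonneg.2 htb)]

section OpNorm

attribute [local instance] Matrix.linftyOpNormedRing Matrix.linftyOpNormedAlgebra
  Matrix.linftyOpNormedAddCommGroup Matrix.linftyOpNormedSpace

variable {n : Type*} [Fintype n] [DecidableEq n]

theorem linftyOpNorm_le {A : Matrix n n ℂ} {r : ℝ} (hr : 0 ≤ r) (h : ∀ i, ∑ j, ‖A i j‖ ≤ r) :
    ‖A‖ ≤ r := by
  rw [Matrix.linfty_opNorm_def]
  lift r to NNReal using hr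
  refine NNReal.coe_le_coe.2 (Finset.sup_le fun i _ => ?_)
  rw [← NNReal.coe_le_coe]
  push_cast
  exact h i

theorem sum_norm_le_linftyOpNorm (A : Matrix n n ℂ) (i : n) : ∑ j, ‖A i j‖ ≤ ‖A‖ := by
  rw [Matrix.linfty_opNorm_def]
  have := Finset.le_sup (f := fun i => ∑ j, ‖A i j‖₊) (Finset.mem_univ i)
  rw [← NNReal.coe_le_coe] at this
  push_cast at this
  exact this

theorem norm_apply_le_linftyOpNorm (A : Matrix n n ℂ) (i j : n) : ‖A i j‖ ≤ ‖A‖ :=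
  (Finset.single_le_sum (f := fun j => ‖A i j‖) (fun _ _ => norm_nonneg _)
    (Finset.mem_univ j)).trans (sum_norm_le_linftyOpNorm A i)

theorem norm_mul_apply_le (A B : Matrix n n ℂ) {b : ℝ} (hB : ∀ i j, ‖B i j‖ ≤ b) (i j : n) :
    ‖(A * B) i j‖ ≤ ‖A‖ * b := by
  have hb : 0 ≤ b := (norm_nonneg _).trans (hB i j)
  calc ‖(A * B) i j‖ ≤ ∑ k, ‖A i k * B k j‖ := norm_sum_le _ _
    _ ≤ ∑ k, ‖A i k‖ * b := Finset.sum_le_sum fun k _ => by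
        rw [norm_mul]; exact mul_le_mul_of_nonneg_left (hB k j) (norm_nonneg _)
    _ ≤ ‖A‖ * b := by
        rw [← Finset.sum_mul]
        exact mul_le_mul_of_nonneg_right (sum_norm_le_linftyOpNorm A i) hb

theorem linftyOpNorm_one_le : ‖(1 : Matrix n n ℂ)‖ ≤ 1 := by
  refine linftyOpNorm_le zero_le_one fun i => ?_
  simp [Matrix.one_apply, apply_ite norm]

/-- The square of `1 + w S` is a strict contraction after division by `4`, when `w` stays away from
`1` and `S`, `S ^ 2` have enough common mass. -/
theorem norm_sq_one_add_smul_le {P : Matrix n n ℝ} (hP : ∀ i j, 0 ≤ P i j)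
    (hrow : ∀ i, ∑ j, P i j ≤ 1) {w : ℂ} (hw : ‖w‖ ≤ 1) {γ : ℝ}
    (hγ : ∀ i, γ ≤ ∑ j, min (2 * P i j) ((P * P) i j)) (hγ4 : γ ≤ 2) :
    ‖(1 + w • P.map Complex.ofReal) ^ 2‖ ≤ 4 - γ * (2 - ‖1 + w‖) := by
  have hg : 0 ≤ 2 - ‖1 + w‖ := by
    have := norm_add_le 1 w
    rw [norm_one] at this
    linarith
  have hPP : ∀ i j, 0 ≤ (P * P) i j := fun i j =>
    Finset.sum_nonneg fun k _ => mul_nonneg (hP i k) (hP k j)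
  have hrow2 : ∀ i, ∑ j, (P * P) i j ≤ 1 := by
    intro i
    simp only [Matrix.mul_apply]
    rw [Finset.sum_comm]
    simp only [← Finset.mul_sum]
    calc _ ≤ ∑ k, P i k * 1 :=
          Finset.sum_le_sum fun k _ => mul_le_mul_of_nonneg_left (hrow k) (hP i k)
      _ ≤ 1 := by simpa using hrow i
  -- The condition `γ ≤ 2` makes the claimed bound non-negative.
  refine linftyOpNorm_le (by nlinarith [norm_nonneg (1 + w)]) fun i => ?_
  have key : ∀ j, ‖((1 + w • P.map Complex.ofReal) ^ 2 : Matrix n n ℂ) i j‖ ≤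
      ‖(1 : Matrix n n ℂ) i j‖
        + (2 * P i j + (P * P) i j - min (2 * P i j) ((P * P) i j) * (2 - ‖1 + w‖)) := by
    intro j
    -- Squaring is what creates overlap: `1` and `P` hardly share mass, but `2 P` and `P²` do, with
    -- relative phase `w`.
    have e : ((1 + w • P.map Complex.ofReal) ^ 2 : Matrix n n ℂ) i j =
        (1 : Matrix n n ℂ) i j + w * (((2 * P i j : ℝ) : ℂ) + w * ((P * P) i j : ℝ)) := by
      have e2 : P.map Complex.ofReal * P.map Complex.ofReal = (P * P).map Complex.ofReal := by
        ext i j; simp [Matrix.mul_apply]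
      rw [sq, add_mul, mul_add, mul_add, one_mul, mul_one, one_mul, Matrix.smul_mul,
        Matrix.mul_smul, e2]
      simp only [Matrix.add_apply, Matrix.smul_apply, Matrix.map_apply, smul_eq_mul]
      push_cast
      ring
    rw [e]
    refine (norm_add_le _ _).trans (add_le_add le_rfl ?_)
    rw [norm_mul]
    have h1 := norm_ofReal_add_mul_ofReal_le hw (a := 2 * P i j) (b := (P * P) i j)
      (le_min (mul_nonneg zero_le_two (hP i j)) (hPP i j)) (min_le_left _ _) (min_le_right _ _)
    exact (mul_le_of_le_one_left (norm_nonneg _) hw).trans h1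
  calc _ ≤ _ := Finset.sum_le_sum fun j _ => key j
    _ = (∑ j, ‖(1 : Matrix n n ℂ) i j‖) + (2 * ∑ j, P i j + ∑ j, (P * P) i j
        - (∑ j, min (2 * P i j) ((P * P) i j)) * (2 - ‖1 + w‖)) := by
      rw [Finset.sum_add_distrib, Finset.sum_sub_distrib, Finset.sum_add_distrib, Finset.mul_sum,
        Finset.sum_mul]
    _ ≤ 1 + (2 * 1 + 1 - γ * (2 - ‖1 + w‖)) := by
      have h1 := (sum_norm_le_linftyOpNorm (1 : Matrix n n ℂ) i).trans linftyOpNorm_one_le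
      have h2 := mul_le_mul_of_nonneg_right (hγ i) hg
      have h3 := hrow i
      have h4 := hrow2 i
      linarith
    _ = _ := by ring

/-- If `‖(1 + B)²‖ ≤ 4 θ` with `θ < 1`, then `1 - B` is invertible, with an approximation of the
inverse by polynomials in `1 + B`. -/
theorem exists_inverse_one_sub {B : Matrix n n ℂ} {θ : ℝ} (hθ0 : 0 ≤ θ) (hθ : θ < 1)
    (hB : ‖B‖ ≤ 2) (hsq : ‖(1 + B) ^ 2‖ ≤ 4 * θ) :
    ∃ Y : Matrix n n ℂ, Y * (1 - B) = 1 ∧ (1 - B) * Y = 1 ∧ ‖Y‖ ≤ 2 / (1 - θ) ∧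
      ∀ p : ℕ, ∃ E : Matrix n n ℂ, ‖E‖ ≤ θ ^ p * (2 / (1 - θ)) ∧
        Y = (1 / 2 : ℂ) • ∑ l ∈ Finset.range (2 * p), ((1 / 2 : ℂ) • (1 + B)) ^ l + E := by
  set X : Matrix n n ℂ := (1 / 2 : ℂ) • (1 + B) with hX
  have h1X : 1 - B = (2 : ℂ) • (1 - X) := by
    rw [hX, smul_sub, smul_smul]; norm_num; rw [two_smul]; abel
  have hX2 : ‖X ^ 2‖ ≤ θ := by
    rw [hX, smul_pow, norm_smul]
    norm_num
    linarith
  have hXn : ‖1 + X‖ ≤ 5 / 2 := by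
    have : 1 + X = (1 / 2 : ℂ) • ((3 : ℂ) • 1 + B) := by
      rw [hX, smul_add, smul_add, smul_smul, ← add_assoc]
      congr 1
      rw [← one_smul ℂ (1 : Matrix n n ℂ), smul_smul, smul_smul, ← add_smul]; norm_num
    rw [this, norm_smul]
    have h3 : ‖(3 : ℂ) • (1 : Matrix n n ℂ) + B‖ ≤ 3 + 2 := by
      refine (norm_add_le _ _).trans (add_le_add ?_ hB)
      rw [norm_smul]
      have := linftyOpNorm_one_le (n := n)
      norm_num
      linarith
    norm_num at h3 ⊢
    linarith
  have : CompleteSpace (Matrix n n ℂ) := FiniteDimensional.complete ℂ _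
  -- Only `X²` is known to be small, so `1 - X²` is inverted and `(1 - X)⁻¹ = (1 + X) (1 - X²)⁻¹` is
  -- used.
  let u := Units.oneSub (X ^ 2) (hX2.trans_lt hθ)
  have hu : (u : Matrix n n ℂ) = 1 - X ^ 2 := rfl
  set Z : Matrix n n ℂ := ↑u⁻¹ with hZ
  have hZ1 : Z * (1 - X ^ 2) = 1 := by rw [← hu, hZ]; exact u.inv_mul
  have hZ2 : (1 - X ^ 2) * Z = 1 := by rw [← hu, hZ]; exact u.mul_inv
  have hZn : ‖Z‖ ≤ 1 / (1 - θ) := by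
    have e : Z = 1 + X ^ 2 * Z := by
      rw [sub_mul, one_mul] at hZ2
      rw [← hZ2]; abel
    have h1 : ‖Z‖ ≤ 1 + θ * ‖Z‖ := by
      calc ‖Z‖ = ‖1 + X ^ 2 * Z‖ := by rw [← e]
        _ ≤ ‖(1 : Matrix n n ℂ)‖ + ‖X ^ 2 * Z‖ := norm_add_le _ _
        _ ≤ 1 + θ * ‖Z‖ := add_le_add linftyOpNorm_one_le
          ((norm_mul_le _ _).trans (mul_le_mul_of_nonneg_right hX2 (norm_nonneg _)))
    rw [le_div_iff₀ (by linarith)]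
    linarith
  have hf1 : (1 - X) * (1 + X) = 1 - X ^ 2 := by noncomm_ring
  have hf2 : (1 + X) * (1 - X) = 1 - X ^ 2 := by noncomm_ring
  have hr : (1 - B) * ((1 / 2 : ℂ) • ((1 + X) * Z)) = 1 := by
    rw [h1X, Matrix.smul_mul, Matrix.mul_smul, smul_smul, ← mul_assoc, hf1, hZ2]; norm_num
  have hl := mul_eq_one_comm.mp hr
  set Y := (1 / 2 : ℂ) • ((1 + X) * Z) with hY
  have hYn : ‖Y‖ ≤ 2 / (1 - θ) := by
    rw [hY, norm_smul]
    have h1 : ‖(1 + X) * Z‖ ≤ 5 / 2 * (1 / (1 - θ)) :=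
      (norm_mul_le _ _).trans (mul_le_mul hXn hZn (norm_nonneg _) (by norm_num))
    have h2 : 0 < 1 / (1 - θ) := one_div_pos.2 (by linarith)
    have h3 : (2 : ℝ) / (1 - θ) = 2 * (1 / (1 - θ)) := by ring
    rw [h3]
    have h4 : ‖(1 / 2 : ℂ)‖ = 1 / 2 := by norm_num
    rw [h4]
    linarith
  -- The remainder of the Neumann series after `2 p` terms.
  refine ⟨Y, hl, hr, hYn, fun p => ⟨X ^ (2 * p) * Y, ?_, ?_⟩⟩
  · refine (norm_mul_le _ _).trans (mul_le_mul ?_ hYn (norm_nonneg _) (pow_nonneg hθ0 p))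
    rw [pow_mul]
    rcases p.eq_zero_or_pos with rfl | hp
    · simpa using linftyOpNorm_one_le
    · exact (norm_pow_le' _ hp).trans (pow_le_pow_left₀ (norm_nonneg _) hX2 p)
  · have hg := geom_sum_mul_neg X (2 * p)
    have e : (∑ l ∈ Finset.range (2 * p), X ^ l) * (1 - X) * Y = (1 - X ^ (2 * p)) * Y := by
      rw [hg]
    have e2 : (1 - X) * Y = (1 / 2 : ℂ) • (1 : Matrix n n ℂ) := by
      have h3 : (1 - B) * Y = (2 : ℂ) • ((1 - X) * Y) := by rw [h1X, Matrix.smul_mul]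
      have h4 := hr.symm.trans h3
      calc (1 - X) * Y = (1 / 2 : ℂ) • ((2 : ℂ) • ((1 - X) * Y)) := by rw [smul_smul]; norm_num
        _ = _ := by rw [← h4]
    rw [mul_assoc, e2, Matrix.mul_smul, mul_one, sub_mul, one_mul] at e
    rw [e]; abel

theorem norm_sq_one_add_le_of_close {B B' : Matrix n n ℂ} {r ε : ℝ} (hB : ‖B‖ ≤ 1)
    (hε : ε ≤ 1) (hsq : ‖(1 + B) ^ 2‖ ≤ r) (h : ‖B' - B‖ ≤ ε) :
    ‖B'‖ ≤ 2 ∧ ‖(1 + B') ^ 2‖ ≤ r + 5 * ε := by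
  have hε0 : 0 ≤ ε := (norm_nonneg _).trans h
  have hB' : ‖B'‖ ≤ 1 + ε := by
    calc ‖B'‖ = ‖B + (B' - B)‖ := by congr 1; abel
      _ ≤ _ := (norm_add_le _ _).trans (add_le_add hB h)
  have h1 : ‖1 + B‖ ≤ 2 := by
    refine (norm_add_le _ _).trans ?_
    linarith [linftyOpNorm_one_le (n := n)]
  have h1' : ‖1 + B'‖ ≤ 3 := by
    refine (norm_add_le _ _).trans ?_
    linarith [linftyOpNorm_one_le (n := n)]
  refine ⟨by linarith, ?_⟩
  have e : (1 + B') ^ 2 = (1 + B) ^ 2 + ((B' - B) * (1 + B) + (1 + B') * (B' - B)) := by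
    noncomm_ring
  rw [e]
  refine (norm_add_le _ _).trans (add_le_add hsq ((norm_add_le _ _).trans ?_))
  have h2 := (norm_mul_le (B' - B) (1 + B)).trans (mul_le_mul h h1 (norm_nonneg _) hε0)
  have h3 := (norm_mul_le (1 + B') (B' - B)).trans (mul_le_mul h1' h (norm_nonneg _) (by norm_num))
  linarith

end OpNorm

/-! ### Green function of a band walk killed in the block -/

section Green

variable {N : ℕ}

/-- Consecutive windows of length `w` have close sums, up to the local energy. -/
theorem sq_window_sub_le (h : ZMod N → ℝ) (a : ZMod N) (w : ℕ) :
    (∑ x ∈ Finset.range w, h (a + x) - ∑ y ∈ Finset.range w, h (a + w + y)) ^ 2 ≤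
      ∑ x ∈ Finset.range w, ∑ s ∈ Finset.range (2 * w), (h (a + x) - h (a + x + s)) ^ 2 := by
  rcases w.eq_zero_or_pos with rfl | hw
  · simp
  have hw' : (0 : ℝ) < w := by exact_mod_cast hw
  set Δ := ∑ x ∈ Finset.range w, h (a + x) - ∑ y ∈ Finset.range w, h (a + w + y)
  -- Each point of the first window is paired with each point of the second; all these pairs are at
  -- forward distance `w + y - x < 2 w`.
  have e : (w : ℝ) * Δ =
      ∑ p ∈ Finset.range w ×ˢ Finset.range w, (h (a + p.1) - h (a + w + p.2)) := by
    rw [Finset.sum_product]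
    simp [Finset.sum_sub_distrib, ← Finset.mul_sum, Δ, mul_sub]
  have h1 : ((w : ℝ) * Δ) ^ 2 ≤ (w : ℝ) ^ 2 *
      ∑ p ∈ Finset.range w ×ˢ Finset.range w, (h (a + p.1) - h (a + w + p.2)) ^ 2 := by
    rw [e]
    refine sq_sum_le_card_mul_sum_sq.trans (le_of_eq ?_)
    simp [sq]
  rw [mul_pow] at h1
  have h2 := le_of_mul_le_mul_left h1 (by positivity)
  refine h2.trans ?_
  rw [Finset.sum_product]
  refine Finset.sum_le_sum fun x hx => ?_
  have hx' := Finset.mem_range.mp hx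
  rw [← Finset.sum_image (f := fun s : ℕ => (h (a + x) - h (a + x + s)) ^ 2)
    (g := fun y : ℕ => w + y - x) (s := Finset.range w) (by
      intro y _ y' _ hyy
      simp only at hyy
      omega) |>.trans (Finset.sum_congr rfl fun y _ => ?_)]
  · refine Finset.sum_le_sum_of_subset_of_nonneg ?_ fun _ _ _ => sq_nonneg _
    intro s hs
    obtain ⟨y, hy, rfl⟩ := Finset.mem_image.mp hs
    have := Finset.mem_range.mp hy
    exact Finset.mem_range.mpr (by omega)
  · have : a + (x : ZMod N) + ((w + y - x : ℕ) : ZMod N) = a + w + y := by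
      rw [Nat.cast_sub (by omega)]; push_cast; ring
    rw [this]

theorem sum_range_mul (F : ℕ → ℝ) (w q : ℕ) :
    ∑ t ∈ Finset.range q, ∑ x ∈ Finset.range w, F (t * w + x) = ∑ l ∈ Finset.range (q * w), F l := by
  induction q with
  | zero => simp
  | succ q ih => rw [Finset.sum_range_succ, ih, Nat.succ_mul, Finset.sum_range_add]

/-- Telescoping over `q` consecutive windows costs a factor `q` by Cauchy–Schwarz. The windows are
disjoint because `q * w ≤ N`, so their local energies add up to at most the total. -/
theorem sq_window_shift_sub_le [NeZero N] (h : ZMod N → ℝ) (a : ZMod N) (w q : ℕ) (hq : q * w ≤ N) :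
    (∑ x ∈ Finset.range w, h (a + (q * w : ℕ) + x) - ∑ x ∈ Finset.range w, h (a + x)) ^ 2 ≤
      q * ∑ k, ∑ s ∈ Finset.range (2 * w), (h k - h (k + s)) ^ 2 := by
  set U : ℕ → ℝ := fun t => ∑ x ∈ Finset.range w, h (a + (t * w : ℕ) + x) with hU
  set Q : ZMod N → ℝ := fun k => ∑ s ∈ Finset.range (2 * w), (h k - h (k + s)) ^ 2 with hQ
  have e : ∑ x ∈ Finset.range w, h (a + (q * w : ℕ) + x) - ∑ x ∈ Finset.range w, h (a + x)
      = ∑ t ∈ Finset.range q, (U (t + 1) - U t) := by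
    rw [Finset.sum_range_sub]; simp [hU]
  rw [e]
  refine sq_sum_le_card_mul_sum_sq.trans ?_
  rw [Finset.card_range]
  refine mul_le_mul_of_nonneg_left ?_ (Nat.cast_nonneg q)
  calc ∑ t ∈ Finset.range q, (U (t + 1) - U t) ^ 2
      ≤ ∑ t ∈ Finset.range q, ∑ x ∈ Finset.range w, Q (a + (t * w + x : ℕ)) := by
        refine Finset.sum_le_sum fun t _ => ?_
        have := sq_window_sub_le h (a + (t * w : ℕ)) w
        have e1 : U (t + 1) = ∑ y ∈ Finset.range w, h (a + (t * w : ℕ) + w + y) := by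
          simp only [hU]
          refine Finset.sum_congr rfl fun y _ => ?_
          congr 1; push_cast; ring
        rw [e1, ← neg_sub, neg_sq]
        refine this.trans (le_of_eq (Finset.sum_congr rfl fun x _ => ?_))
        simp only [hQ]
        push_cast
        simp only [add_assoc]
    _ = ∑ l ∈ Finset.range (q * w), Q (a + l) := sum_range_mul (fun l => Q (a + l)) w q
    _ ≤ ∑ k, Q k := sum_range_add_natCast_le Q a hq Finset.univ
        (fun k _ => Finset.sum_nonneg fun _ _ => sq_nonneg _) fun _ _ => Finset.mem_univ _

/-- Every window sum is controlled by the mass in the block and the local energy. -/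
theorem sq_window_le [NeZero N] {W w : ℕ} (hw : 0 < w) (hwW : 2 * w ≤ W) (hWN : W ≤ N) (h : ZMod N → ℝ)
    (i : ZMod N) :
    w * (∑ x ∈ Finset.range w, h (i + x)) ^ 2 ≤ 2 * w ^ 2 * ∑ k ∈ block N W, h k ^ 2 +
      2 * N * ∑ k, ∑ j, if cabs (k - j) ≤ W then (h k - h j) ^ 2 else 0 := by
  -- The block starts at `1`. Moving back from `i` by `q` windows leads to a start `1 + ρ` with `ρ <
  -- w`, and the window there lies in the block since `2 * w ≤ W`.
  set r := (i - 1).val with hr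
  have hrN : r < N := ZMod.val_lt _
  set q := r / w
  set ρ := r % w
  have hρ : ρ < w := Nat.mod_lt _ hw
  have hqr : q * w + ρ = r := by rw [mul_comm]; exact Nat.div_add_mod r w
  have hi : i = 1 + (ρ : ZMod N) + (q * w : ℕ) := by
    have : ((r : ℕ) : ZMod N) = i - 1 := by rw [hr, ZMod.natCast_zmod_val]
    rw [← hqr] at this
    push_cast at this ⊢
    linear_combination -this
  have h1 := sq_window_shift_sub_le h (1 + (ρ : ZMod N)) w q (by omega)
  rw [← hi] at h1
  set U := ∑ x ∈ Finset.range w, h (i + x)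
  set U₀ := ∑ x ∈ Finset.range w, h (1 + (ρ : ZMod N) + x)
  have hU₀ : U₀ ^ 2 ≤ w * ∑ k ∈ block N W, h k ^ 2 := by
    refine (sq_sum_le_card_mul_sum_sq).trans ?_
    rw [Finset.card_range]
    refine mul_le_mul_of_nonneg_left ?_ (Nat.cast_nonneg w)
    refine sum_range_add_natCast_le (fun k => h k ^ 2) _ (by omega) _ (fun _ _ => sq_nonneg _) ?_
    intro x hx
    refine Finset.mem_image.mpr ⟨1 + ρ + x, Finset.mem_Icc.mpr (by omega), by push_cast; ring⟩
  have hQ : ∑ k, ∑ s ∈ Finset.range (2 * w), (h k - h (k + s)) ^ 2 ≤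
      ∑ k, ∑ j, if cabs (k - j) ≤ W then (h k - h j) ^ 2 else 0 := by
    refine Finset.sum_le_sum fun k _ => ?_
    rw [← Finset.sum_filter]
    refine sum_range_add_natCast_le (fun j => (h k - h j) ^ 2) k (by omega) _
      (fun _ _ => sq_nonneg _) fun x hx => ?_
    refine Finset.mem_filter.mpr ⟨Finset.mem_univ _, ?_⟩
    have := cabs_add_natCast_sub_le k 0 x (L := W) (by omega) (by omega)
    simpa using this
  set E := ∑ k, ∑ j, if cabs (k - j) ≤ W then (h k - h j) ^ 2 else 0
  have hE : 0 ≤ E := Finset.sum_nonneg fun k _ => Finset.sum_nonneg fun j _ => by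
    split_ifs <;> positivity
  have hqN : (w : ℝ) * q ≤ N := by
    have : w * q ≤ N := by rw [mul_comm]; omega
    exact_mod_cast this
  have hU : U ^ 2 ≤ 2 * U₀ ^ 2 + 2 * (q * E) := by
    have h2 : (U - U₀) ^ 2 ≤ q * E := h1.trans (mul_le_mul_of_nonneg_left hQ (Nat.cast_nonneg q))
    nlinarith [sq_nonneg (U - 2 * U₀)]
  have hw0 : (0 : ℝ) ≤ w := Nat.cast_nonneg w
  calc (w : ℝ) * U ^ 2 ≤ w * (2 * (w * ∑ k ∈ block N W, h k ^ 2) + 2 * (q * E)) :=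
        mul_le_mul_of_nonneg_left (by linarith) hw0
    _ = 2 * w ^ 2 * ∑ k ∈ block N W, h k ^ 2 + 2 * (w * q * E) := by ring
    _ ≤ _ := by
        have := mul_le_mul_of_nonneg_right hqN hE
        linarith

/-- A ball is covered by windows. -/
theorem sum_ball_le [NeZero N] {w J : ℕ} (h : ZMod N → ℝ) (hh : ∀ k, 0 ≤ h k) (i : ZMod N)
    {r u : ℝ} (hr : r ≤ J * w) (hw : 0 < w)
    (hu : ∀ a : ZMod N, ∑ x ∈ Finset.range w, h (a + x) ≤ u) :
    ∑ k, (if (cabs (i - k) : ℝ) ≤ r then h k else 0) ≤ (2 * J + 1) * u := by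
  set a : ZMod N := i - (J * w : ℕ)
  have h1 : ∑ k, (if (cabs (i - k) : ℝ) ≤ r then h k else 0) ≤
      ∑ l ∈ Finset.range ((2 * J + 1) * w), h (a + l) := by
    rw [← Finset.sum_filter]
    have hsub : (Finset.univ.filter fun k => (cabs (i - k) : ℝ) ≤ r) ⊆
        (Finset.range ((2 * J + 1) * w)).image fun l : ℕ => a + (l : ZMod N) := by
      intro k hk
      have hk' : cabs (i - k) ≤ J * w := by
        have := (Finset.mem_filter.mp hk).2.trans hr
        exact_mod_cast this
      set v := (i - k).valMinAbs
      have hv : v.natAbs ≤ J * w := hk'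
      have hvk : ((v : ℤ) : ZMod N) = i - k := ZMod.coe_valMinAbs _
      refine Finset.mem_image.mpr ⟨((J * w : ℕ) - v).toNat, Finset.mem_range.mpr ?_, ?_⟩
      · have : (2 * J + 1) * w = 2 * (J * w) + w := by ring
        omega
      · have h3 : ((((J * w : ℕ) - v).toNat : ℕ) : ℤ) = (J * w : ℕ) - v :=
          Int.toNat_of_nonneg (by omega)
        have h4 : ((((J * w : ℕ) - v).toNat : ℕ) : ZMod N) = ((J * w : ℕ) : ZMod N) - (i - k) := by
          rw [← hvk, ← Int.cast_natCast, h3]; push_cast; ring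
        rw [h4]; simp [a]
    refine (Finset.sum_le_sum_of_subset_of_nonneg hsub fun _ _ _ => hh _).trans ?_
    exact Finset.sum_image_le_of_nonneg (fun _ _ => hh _)
  refine h1.trans ?_
  rw [← sum_range_mul (fun l => h (a + l))]
  calc _ ≤ ∑ t ∈ Finset.range (2 * J + 1), u := Finset.sum_le_sum fun t _ => by
        have := hu (a + (t * w : ℕ))
        refine le_trans (le_of_eq (Finset.sum_congr rfl fun x _ => ?_)) this
        push_cast; rw [add_assoc]
    _ = _ := by simp

/-- The energy identity for a symmetric weighted graph with killing. -/
theorem sum_mul_eq_energy {n : Type*} [Fintype n] {T : n → n → ℝ} (hT : ∀ i j, T i j = T j i)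
    (k φ b : n → ℝ) (hb : ∀ i, k i * φ i + ∑ j, T i j * (φ i - φ j) = b i) :
    ∑ i, φ i * b i = ∑ i, k i * φ i ^ 2 + (∑ i, ∑ j, T i j * (φ i - φ j) ^ 2) / 2 := by
  have e1 : ∑ i, φ i * b i = ∑ i, k i * φ i ^ 2 + ∑ i, ∑ j, T i j * (φ i - φ j) * φ i := by
    rw [← Finset.sum_add_distrib]
    refine Finset.sum_congr rfl fun i _ => ?_
    rw [← hb i, ← Finset.sum_mul]; ring
  have e2 : ∑ i, ∑ j, T i j * (φ i - φ j) * φ i = -∑ i, ∑ j, T i j * (φ i - φ j) * φ j := by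
    rw [Finset.sum_comm, ← Finset.sum_neg_distrib]
    refine Finset.sum_congr rfl fun i _ => ?_
    rw [← Finset.sum_neg_distrib]
    refine Finset.sum_congr rfl fun j _ => ?_
    rw [hT j i]; ring
  have e3 : ∑ i, ∑ j, T i j * (φ i - φ j) ^ 2 =
      ∑ i, ∑ j, T i j * (φ i - φ j) * φ i - ∑ i, ∑ j, T i j * (φ i - φ j) * φ j := by
    rw [← Finset.sum_sub_distrib]
    refine Finset.sum_congr rfl fun i _ => ?_
    rw [← Finset.sum_sub_distrib]
    refine Finset.sum_congr rfl fun j _ => ?_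
    ring
  rw [e1, e3]
  linarith

/-- Young's inequality absorbs half of `c / 3 * H` from the square root. -/
theorem le_of_mul_le_add_mul_sqrt {c α H B Z : ℝ} (hc : 0 < c) (hH : 0 ≤ H)
    (hB : 0 ≤ B) (hZ : 0 ≤ Z) (h : c / 3 * H ≤ B + α * Real.sqrt (H * (108 / c * Z))) :
    H ≤ (6 / c + 6 / c * (3 * α ^ 2 / (2 * c) * (108 / c))) * (B + Z) := by
  have hA : 0 ≤ 108 / c * Z := by positivity
  have h1 : α * Real.sqrt (H * (108 / c * Z)) ≤
      c / 6 * H + 3 * α ^ 2 / (2 * c) * (108 / c * Z) := by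
    generalize 108 / c * Z = A at hA
    refine (abs_le_of_sq_le_sq' ?_ (by positivity)).2
    rw [mul_pow, Real.sq_sqrt (by positivity)]
    have e : 4 * ((c / 6 * H) * (3 * α ^ 2 / (2 * c) * A)) = α ^ 2 * (H * A) := by
      field_simp; ring
    rw [← e]
    generalize c / 6 * H = x
    generalize 3 * α ^ 2 / (2 * c) * A = y
    nlinarith [sq_nonneg (x - y)]
  have hD : 0 ≤ 3 * α ^ 2 / (2 * c) * (108 / c) := by positivity
  have h2 : c / 6 * H ≤ B + 3 * α ^ 2 / (2 * c) * (108 / c) * Z := by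
    rw [mul_assoc (3 * α ^ 2 / (2 * c))]
    linarith
  generalize 3 * α ^ 2 / (2 * c) * (108 / c) = D at hD h2
  have h6 : 0 ≤ 6 / c := by positivity
  have h3 := mul_le_mul_of_nonneg_left h2 h6
  rw [show 6 / c * (c / 6 * H) = H by field_simp] at h3
  have h4 := mul_nonneg h6 (mul_nonneg hD hB)
  have h5 := mul_nonneg h6 hZ
  refine h3.trans (le_of_sub_nonneg ?_)
  rw [show (6 / c + 6 / c * D) * (B + Z) - 6 / c * (B + D * Z) = 6 / c * (D * B) + 6 / c * Z by
    ring]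
  exact add_nonneg h4 h5

/-- Sup bound for the Green function of a band walk on the cycle which is killed in the block. -/
theorem green_bound {c C : ℝ} (hc : 0 < c) (hC : 0 < C) : ∃ K : ℝ, 0 < K ∧
    ∀ (N : ℕ) [NeZero N] (W : ℕ) (T : ZMod N → ZMod N → ℝ) (k φ b : ZMod N → ℝ) (η B B₁ : ℝ),
      2 ≤ W → W ≤ N → 0 < η → (∀ i j, T i j = T j i) → (∀ i j, 0 ≤ T i j) →
      (∀ i j, cabs (i - j) ≤ W → c / W ≤ T i j) →
      (∀ i j, T i j ≤ if (cabs (i - j) : ℝ) ≤ C * W then C / W else 0) →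
      (∀ i, 0 ≤ k i) → (∀ i ∈ block N W, c * η ≤ k i) →
      (∀ i, k i * φ i + ∑ j, T i j * (φ i - φ j) = b i) →
      (∀ i, |b i| ≤ B) → ∑ i, |b i| ≤ B₁ →
      ∀ i, |φ i| ≤ K * (B + B₁ * (1 / (W * η) + N / (W : ℝ) ^ 2)) := by
  -- A ball of radius `C * W` needs `2 * J + 1` windows with `J ≤ 3 * C + 1`.
  set α : ℝ := C * (6 * C + 3)
  have hα : 0 < α := by positivity
  refine ⟨6 / c + 6 / c * (3 * α ^ 2 / (2 * c) * (108 / c)), by positivity, ?_⟩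
  intro N _ W T k φ b η B B₁ hW hWN hη hTs hT0 hTl hTu hk0 hkb heq hbB hbB₁ i
  obtain ⟨i₀, -, hi₀⟩ := Finset.exists_max_image Finset.univ (fun i => |φ i|) ⟨0, Finset.mem_univ _⟩
  set H := |φ i₀|
  have hH0 : 0 ≤ H := abs_nonneg _
  have hH : ∀ i, |φ i| ≤ H := fun i => hi₀ i (Finset.mem_univ i)
  refine (hH i).trans ?_
  have hB₁ : 0 ≤ B₁ := (Finset.sum_nonneg fun i _ => abs_nonneg _).trans hbB₁
  have hB : 0 ≤ B := (abs_nonneg _).trans (hbB i)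
  have hW0 : (0 : ℝ) < W := by exact_mod_cast (by omega : 0 < W)
  set w := W / 2
  have hw : 0 < w := by omega
  have hw0 : (0 : ℝ) < w := by exact_mod_cast hw
  have hwW : (W : ℝ) ≤ 3 * w := by exact_mod_cast (by omega : W ≤ 3 * w)
  have hwW2 : (w : ℝ) ≤ W := by exact_mod_cast (by omega : w ≤ W)
  set R : ℝ := 1 / (W * η) + N / (W : ℝ) ^ 2
  have hR : 0 ≤ R := by positivity
  have hE := sum_mul_eq_energy hTs k φ b heq
  have hEle : ∑ i, φ i * b i ≤ H * B₁ := by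
    calc ∑ i, φ i * b i ≤ ∑ i, H * |b i| := Finset.sum_le_sum fun i _ => by
          refine (le_abs_self _).trans ?_
          rw [abs_mul]
          exact mul_le_mul_of_nonneg_right (hH i) (abs_nonneg _)
      _ ≤ H * B₁ := by rw [← Finset.mul_sum]; exact mul_le_mul_of_nonneg_left hbB₁ hH0
  -- Absolute values do not increase the Dirichlet energy, and sums over balls can then be bounded
  -- by covering.
  set h : ZMod N → ℝ := fun i => |φ i|
  have hE1 : c * η * ∑ k ∈ block N W, h k ^ 2 ≤ ∑ i, k i * φ i ^ 2 := by
    rw [Finset.mul_sum]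
    calc _ ≤ ∑ i ∈ block N W, k i * φ i ^ 2 := Finset.sum_le_sum fun i hi => by
          simp only [h, sq_abs]
          exact mul_le_mul_of_nonneg_right (hkb i hi) (sq_nonneg _)
      _ ≤ _ := Finset.sum_le_sum_of_subset_of_nonneg (Finset.subset_univ _)
          fun i _ _ => mul_nonneg (hk0 i) (sq_nonneg _)
  have hE2 : c / W * ∑ k, ∑ j, (if cabs (k - j) ≤ W then (h k - h j) ^ 2 else 0) ≤
      ∑ i, ∑ j, T i j * (φ i - φ j) ^ 2 := by
    rw [Finset.mul_sum]
    refine Finset.sum_le_sum fun i _ => ?_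
    rw [Finset.mul_sum]
    refine Finset.sum_le_sum fun j _ => ?_
    split_ifs with hij
    · refine mul_le_mul (hTl i j hij) ?_ (sq_nonneg _) (hT0 i j)
      rw [← sq_abs (h i - h j), ← sq_abs (φ i - φ j)]
      exact pow_le_pow_left₀ (abs_nonneg _) (abs_abs_sub_abs_le _ _) 2
    · rw [mul_zero]; exact mul_nonneg (hT0 i j) (sq_nonneg _)
  have hE1' : 0 ≤ ∑ i, k i * φ i ^ 2 :=
    Finset.sum_nonneg fun i _ => mul_nonneg (hk0 i) (sq_nonneg _)
  have hE2' : 0 ≤ ∑ i, ∑ j, T i j * (φ i - φ j) ^ 2 :=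
    Finset.sum_nonneg fun i _ => Finset.sum_nonneg fun j _ => mul_nonneg (hT0 i j) (sq_nonneg _)
  -- The energy is at most `H * B₁`, so window sums are of order `W √P` with `P` linear in the
  -- unknown maximum `H`.
  set P := H * B₁ * (108 / c * R)
  have hP : 0 ≤ P := by positivity
  have hU : ∀ a : ZMod N, ∑ x ∈ Finset.range w, h (a + x) ≤ W * Real.sqrt P := by
    intro a
    have h1 := sq_window_le hw (by omega) hWN h a
    set U := ∑ x ∈ Finset.range w, h (a + x)
    set E₁ := ∑ k ∈ block N W, h k ^ 2
    set E₂ := ∑ k, ∑ j, if cabs (k - j) ≤ W then (h k - h j) ^ 2 else 0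
    have h2 : E₁ ≤ H * B₁ / (c * η) := by
      rw [le_div_iff₀ (by positivity)]; linarith
    have h3 : E₂ ≤ 2 * W * (H * B₁) / c := by
      rw [le_div_iff₀ hc]
      have : c / W * E₂ ≤ 2 * (H * B₁) := by linarith
      rw [div_mul_eq_mul_div, div_le_iff₀ hW0] at this
      linarith
    have h4 : U ^ 2 ≤ W ^ 2 * P := by
      have h5 : w * U ^ 2 ≤ 2 * w ^ 2 * (H * B₁ / (c * η)) + 2 * N * (2 * W * (H * B₁) / c) := by
        refine h1.trans (add_le_add ?_ ?_)
        · exact mul_le_mul_of_nonneg_left h2 (by positivity)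
        · exact mul_le_mul_of_nonneg_left h3 (by positivity)
      refine le_of_mul_le_mul_left (h5.trans ?_) hw0
      have e : (w : ℝ) * (W ^ 2 * P) = w * W * (108 * (H * B₁ / (c * η)))
          + w * N * (108 * ((H * B₁) / c)) := by
        simp only [P, R]; field_simp
      rw [e]
      have hX : 0 ≤ H * B₁ / (c * η) := by positivity
      have hY : 0 ≤ H * B₁ / c := by positivity
      refine add_le_add ?_ ?_
      · have : (w : ℝ) * w ≤ w * W := mul_le_mul_of_nonneg_left hwW2 hw0.le
        nlinarith [mul_le_mul_of_nonneg_right this hX, mul_nonneg (mul_nonneg hw0.le hW0.le) hX]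
      · have e2 : 2 * (N : ℝ) * (2 * W * (H * B₁) / c) = 4 * (N * (H * B₁ / c)) * W := by ring
        rw [e2]
        have hNY : 0 ≤ (N : ℝ) * (H * B₁ / c) := by positivity
        nlinarith [mul_le_mul_of_nonneg_left hwW hNY, mul_nonneg hNY hw0.le]
    have h6 : |U| ≤ Real.sqrt (W ^ 2 * P) := Real.abs_le_sqrt h4
    rw [Real.sqrt_mul (sq_nonneg _), Real.sqrt_sq hW0.le] at h6
    exact (le_abs_self _).trans h6
  set J := ⌈C * W / w⌉₊
  have hJ : C * W ≤ J * w := by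
    have := Nat.le_ceil (C * W / w)
    rwa [div_le_iff₀ hw0] at this
  have hJ2 : (J : ℝ) ≤ 3 * C + 1 := by
    refine (Nat.ceil_lt_add_one (by positivity)).le.trans ?_
    gcongr
    rw [div_le_iff₀ hw0]
    nlinarith
  have hball := sum_ball_le (J := J) h (fun _ => abs_nonneg _) i₀ hJ hw hU
  have hTsum : c / 3 ≤ ∑ j, T i₀ j := by
    have h1 := sum_range_add_natCast_le (T i₀) i₀ (L := w) (by omega) Finset.univ
      (fun j _ => hT0 i₀ j) fun _ _ => Finset.mem_univ _
    have h2 : (w : ℝ) * (c / W) ≤ ∑ x ∈ Finset.range w, T i₀ (i₀ + x) := by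
      have : ∑ x ∈ Finset.range w, (c / W : ℝ) ≤ ∑ x ∈ Finset.range w, T i₀ (i₀ + x) := by
        refine Finset.sum_le_sum fun x hx => hTl _ _ ?_
        have hx' := Finset.mem_range.mp hx
        have := cabs_add_natCast_sub_le i₀ 0 x (L := W) (by omega) (by omega)
        simpa using this
      simpa using this
    have h3 : c / 3 ≤ w * (c / W) := by
      rw [mul_div_assoc', le_div_iff₀ hW0]
      nlinarith
    linarith
  -- The equation at the maximum bounds `H` by the source and a local average of `|φ|`. As this
  -- average is `O(√H)`, the inequality closes.
  have hrow : c / 3 * H ≤ B + α * Real.sqrt P := by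
    have e : (k i₀ + ∑ j, T i₀ j) * φ i₀ = b i₀ + ∑ j, T i₀ j * φ j := by
      rw [← heq i₀]
      simp only [mul_sub, Finset.sum_sub_distrib, ← Finset.sum_mul]
      ring
    have h1 : |∑ j, T i₀ j * φ j| ≤ α * Real.sqrt P := by
      calc |∑ j, T i₀ j * φ j| ≤ ∑ j, |T i₀ j * φ j| := Finset.abs_sum_le_sum_abs _ _
        _ ≤ ∑ j, C / W * (if (cabs (i₀ - j) : ℝ) ≤ C * W then h j else 0) := by
            refine Finset.sum_le_sum fun j _ => ?_
            rw [abs_mul, abs_of_nonneg (hT0 i₀ j)]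
            have := mul_le_mul_of_nonneg_right (hTu i₀ j) (abs_nonneg (φ j))
            split_ifs at this ⊢ <;> simpa [h] using this
        _ ≤ C / W * ((2 * J + 1) * (W * Real.sqrt P)) := by
            rw [← Finset.mul_sum]
            exact mul_le_mul_of_nonneg_left hball (by positivity)
        _ = C * (2 * J + 1) * Real.sqrt P := by field_simp
        _ ≤ α * Real.sqrt P := by
            refine mul_le_mul_of_nonneg_right ?_ (Real.sqrt_nonneg _)
            exact mul_le_mul_of_nonneg_left (by linarith) hC.le
    have h2 : (k i₀ + ∑ j, T i₀ j) * H ≤ B + α * Real.sqrt P := by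
      have hpos : 0 ≤ k i₀ + ∑ j, T i₀ j :=
        add_nonneg (hk0 _) (Finset.sum_nonneg fun j _ => hT0 _ _)
      rw [← abs_of_nonneg hpos, ← abs_mul, e]
      exact (abs_add_le _ _).trans (add_le_add (hbB _) h1)
    have h3 : c / 3 * H ≤ (k i₀ + ∑ j, T i₀ j) * H :=
      mul_le_mul_of_nonneg_right (by linarith [hk0 i₀]) hH0
    linarith
  refine le_of_mul_le_add_mul_sqrt hc hH0 hB (mul_nonneg hB₁ hR) ?_
  rwa [show H * (108 / c * (B₁ * R)) = P by simp only [P]; ring]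

end Green

/-! ### The semicircle transform in the bulk -/

theorem msc_im_nonneg {z : ℂ} (hz : 0 ≤ z.im) (h2 : |z.re| < 2) : 0 ≤ (msc z).im := by
  have h := (Complex.continuous_im.tendsto _).comp (tendsto_msc hz h2)
  refine ge_of_tendsto h ?_
  filter_upwards [self_mem_nhdsWithin] with t ht
  have ht' : (0 : ℝ) < t := ht
  refine (msc_im_pos ?_).le
  simp
  linarith

/-- Bounds on the semicircle Stieltjes transform in the bulk. -/
theorem msc_bounds {κ : ℝ} (hκ : 0 < κ) {z : ℂ} (he : |z.re| < 2 - κ) (h0 : 0 ≤ z.im)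
    (h1 : z.im ≤ 1) :
    ‖msc z‖ ≤ 1 ∧ 1 / 4 ≤ ‖msc z‖ ∧ 0 < (msc z).im ∧ κ / 32 ≤ (msc z).im ^ 2 := by
  have hy0 := msc_im_nonneg h0 (he.trans (by linarith))
  have heq := msc_equation z
  set m := msc z
  have hn : ‖m‖ ^ 2 = m.re ^ 2 + m.im ^ 2 := by
    rw [← Complex.normSq_eq_norm_sq, Complex.normSq_apply]; ring
  have hmul : ‖m‖ * ‖m + z‖ = 1 := by
    rw [← norm_mul, show m * (m + z) = -1 by linear_combination heq]; simp
  have hz3 : ‖z‖ ≤ 3 := (Complex.norm_le_abs_re_add_abs_im z).trans (by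
    rw [abs_of_nonneg h0]; linarith)
  have hre := congrArg Complex.re heq
  have him := congrArg Complex.im heq
  simp only [sq, Complex.add_re, Complex.mul_re, Complex.add_im, Complex.mul_im, Complex.one_re,
    Complex.one_im, Complex.zero_re, Complex.zero_im] at hre him
  obtain ⟨hl, hr⟩ := abs_lt.mp he
  set x := m.re
  set y := m.im
  set a := z.re
  set t := z.im
  -- `e1` and `e2` are the imaginary and real parts of the quadratic equation multiplied by the
  -- conjugate of `m`.
  have e1 : y * (1 - (x ^ 2 + y ^ 2)) = t * (x ^ 2 + y ^ 2) := by
    linear_combination y * hre - x * him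
  have e2 : x * (1 + (x ^ 2 + y ^ 2)) = -a * (x ^ 2 + y ^ 2) := by
    linear_combination x * hre + y * him
  have hy : 0 < y := by
    rcases hy0.lt_or_eq with h | h
    · exact h
    · exfalso
      rw [← h] at hre him
      nlinarith [sq_nonneg (2 * x + a)]
  have hρ0 : 0 < x ^ 2 + y ^ 2 := by positivity
  have hρ1 : x ^ 2 + y ^ 2 ≤ 1 := by
    by_contra hcon
    push Not at hcon
    nlinarith
  have hm1 : ‖m‖ ≤ 1 := by
    rw [← sq_le_one_iff₀ (norm_nonneg _), hn]; exact hρ1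
  have hm4 : 1 / 4 ≤ ‖m‖ := by
    have h4 : ‖m + z‖ ≤ 4 := (norm_add_le _ _).trans (by linarith)
    nlinarith [norm_nonneg m]
  refine ⟨hm1, hm4, hy, ?_⟩
  have hρ2 : 1 / 16 ≤ x ^ 2 + y ^ 2 := by rw [← hn]; nlinarith
  generalize hρ : x ^ 2 + y ^ 2 = ρ at *
  -- By `4 ρ ≤ (1 + ρ)²`. Then `y² = ρ - x² ≥ ρ (1 - a² / 4) ≥ (1 / 16) (κ / 2)`.
  have hx2 : x ^ 2 ≤ a ^ 2 / 4 * ρ := by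
    have h5 : x ^ 2 * (1 + ρ) ^ 2 = a ^ 2 * ρ ^ 2 := by
      linear_combination (x * (1 + ρ) - a * ρ) * e2
    have h6 : 4 * ρ * (a ^ 2 * ρ) ≤ (1 + ρ) ^ 2 * (a ^ 2 * ρ) :=
      mul_le_mul_of_nonneg_right (by nlinarith [sq_nonneg (1 - ρ)]) (by positivity)
    have h7 : x ^ 2 * (1 + ρ) ^ 2 ≤ a ^ 2 / 4 * ρ * (1 + ρ) ^ 2 := by linarith
    exact le_of_mul_le_mul_right h7 (by positivity)
  have ha : κ / 2 ≤ 1 - a ^ 2 / 4 := by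
    have : a ^ 2 ≤ (2 - κ) ^ 2 := sq_le_sq' (by linarith) hr.le
    nlinarith [abs_nonneg a]
  nlinarith

/-! ### Existence and uniqueness near a constant solution -/

section FixedPoint

attribute [local instance] Matrix.linftyOpNormedRing Matrix.linftyOpNormedAlgebra
  Matrix.linftyOpNormedAddCommGroup Matrix.linftyOpNormedSpace

variable {n : Type*} [Fintype n] [DecidableEq n]

/-- The expression is the quadratic remainder `u² / (m + u)`, whose Lipschitz constant is of order
`δ`: numerator at most `3 δ`, denominator at least `1 / 64`. -/
theorem norm_remainder_sub_le {m u u' : ℂ} {δ : ℝ} (hm1 : ‖m‖ ≤ 1) (hm4 : 1 / 4 ≤ ‖m‖)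
    (hδ : δ ≤ 1 / 8) (hu : ‖u‖ ≤ δ) (hu' : ‖u'‖ ≤ δ) :
    ‖(u - m + m ^ 2 / (m + u)) - (u' - m + m ^ 2 / (m + u'))‖ ≤ 192 * δ * ‖u - u'‖ := by
  have hδ0 : 0 ≤ δ := (norm_nonneg _).trans hu
  have hlow : ∀ v : ℂ, ‖v‖ ≤ δ → 1 / 8 ≤ ‖m + v‖ := by
    intro v hv
    have := norm_sub_norm_le m (-v)
    rw [sub_neg_eq_add, norm_neg] at this
    linarith
  have h1 := hlow u hu
  have h1' := hlow u' hu'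
  have hne : m + u ≠ 0 := norm_pos_iff.mp (by linarith)
  have hne' : m + u' ≠ 0 := norm_pos_iff.mp (by linarith)
  have e : (u - m + m ^ 2 / (m + u)) - (u' - m + m ^ 2 / (m + u')) =
      (m * (u + u') + u * u') / ((m + u) * (m + u')) * (u - u') := by
    field_simp
    ring
  rw [e, norm_mul]
  refine mul_le_mul_of_nonneg_right ?_ (norm_nonneg _)
  rw [norm_div, norm_mul, div_le_iff₀ (by positivity)]
  have h2 : ‖m * (u + u') + u * u'‖ ≤ 3 * δ := by
    refine (norm_add_le _ _).trans ?_
    rw [norm_mul, norm_mul]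
    have := norm_add_le u u'
    nlinarith [norm_nonneg u, norm_nonneg u', norm_nonneg m, norm_nonneg (u + u')]
  have h3 : 1 / 64 ≤ ‖m + u‖ * ‖m + u'‖ := by nlinarith
  nlinarith

/-- Multiplication by `m²` isolates the linearization `u - m² s` from the quadratic remainder and
the perturbation `d`. -/
theorem inv_add_eq_iff {m zt u s d : ℂ} (hm : m ^ 2 + zt * m + 1 = 0) (hm0 : m ≠ 0) :
    (m + u)⁻¹ = -zt - m - s - d ↔
      u - m ^ 2 * s = u - m + m ^ 2 / (m + u) + m ^ 2 * d := by
  have h1 : m ^ 2 * (-zt - m) = m := by linear_combination -m * hm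
  have h2 : m ^ 2 ≠ 0 := pow_ne_zero 2 hm0
  rw [div_eq_mul_inv]
  constructor
  · intro h
    rw [h]; linear_combination -h1
  · intro h
    refine mul_left_cancel₀ h2 ?_
    linear_combination -h - h1

/-- The perturbed quadratic vector equation near a constant solution `m` has exactly one solution
in a small ball, provided the linearization at `m` is invertible. -/
theorem exists_unique_near {P Y Γ : Matrix n n ℂ} {m zt : ℂ} {d : n → ℂ} {K δ ε : ℝ}
    (hm : m ^ 2 + zt * m + 1 = 0) (hm1 : ‖m‖ ≤ 1) (hm4 : 1 / 4 ≤ ‖m‖)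
    (hYl : Y * (1 - m ^ 2 • P) = 1) (hYr : (1 - m ^ 2 • P) * Y = 1) (hY : ‖Y‖ ≤ K)
    (hK : 0 < K) (hδ : 0 < δ) (hδ8 : δ ≤ 1 / 8) (hKδ : 768 * K * δ ≤ 1)
    (hKε : 4 * K * ε ≤ δ) (hΓ : ‖Γ‖ ≤ ε) (hd : ∀ i, ‖d i‖ ≤ ε) :
    ∃ u : n → ℂ, (∀ i, ‖u i‖ ≤ δ) ∧
      (∀ i, (m + u i)⁻¹ = -zt - m - (P.mulVec u) i - (d i + (Γ.mulVec u) i)) ∧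
      ∀ u' : n → ℂ, (∀ i, ‖u' i‖ ≤ δ) →
        (∀ i, (m + u' i)⁻¹ = -zt - m - (P.mulVec u') i - (d i + (Γ.mulVec u') i)) → u' = u := by
  have hε : 0 ≤ ε := (norm_nonneg _).trans hΓ
  have hm0 : m ≠ 0 := norm_pos_iff.mp (by linarith)
  set q : ℂ → ℂ := fun u => u - m + m ^ 2 / (m + u)
  set G : (n → ℂ) → n → ℂ := fun u i => q (u i) + m ^ 2 * (d i + (Γ.mulVec u) i)
  set Φ : (n → ℂ) → n → ℂ := fun u => Y.mulVec (G u)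
  have hiff : ∀ u : n → ℂ,
      (∀ i, (m + u i)⁻¹ = -zt - m - (P.mulVec u) i - (d i + (Γ.mulVec u) i)) ↔ Φ u = u := by
    intro u
    have h1 : (∀ i, (m + u i)⁻¹ = -zt - m - (P.mulVec u) i - (d i + (Γ.mulVec u) i)) ↔
        (1 - m ^ 2 • P).mulVec u = G u := by
      rw [funext_iff]
      refine forall_congr' fun i => ?_
      rw [inv_add_eq_iff hm hm0, Matrix.sub_mulVec, Matrix.one_mulVec, Matrix.smul_mulVec]
      simp [G, q]
    rw [h1]
    constructor
    · intro h
      simp only [Φ]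
      rw [← h, Matrix.mulVec_mulVec, hYl, Matrix.one_mulVec]
    · intro h
      conv_lhs => rw [← h]
      simp only [Φ]
      rw [Matrix.mulVec_mulVec, hYr, Matrix.one_mulVec]
  have hm2 : ‖m ^ 2‖ ≤ 1 := by rw [norm_pow]; exact pow_le_one₀ (norm_nonneg _) hm1
  -- The constant is `K (192 δ + ε)`, where `192 K δ ≤ 1 / 4` and `K ε ≤ δ / 4 ≤ 1 / 32`.
  have hlip : ∀ u u' : n → ℂ, ‖u‖ ≤ δ → ‖u'‖ ≤ δ → ‖Φ u - Φ u'‖ ≤ 1 / 2 * ‖u - u'‖ := by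
    intro u u' hu hu'
    have hG : ‖G u - G u'‖ ≤ (192 * δ + ε) * ‖u - u'‖ := by
      refine (pi_norm_le_iff_of_nonneg (by positivity)).2 fun i => ?_
      have e : (G u - G u') i = (q (u i) - q (u' i)) + m ^ 2 * (Γ.mulVec (u - u')) i := by
        simp only [G, Pi.sub_apply, Matrix.mulVec_sub]; ring
      rw [e, add_mul]
      refine (norm_add_le _ _).trans (add_le_add ?_ ?_)
      · refine (norm_remainder_sub_le hm1 hm4 hδ8 ((norm_le_pi_norm u i).trans hu)
          ((norm_le_pi_norm u' i).trans hu')).trans ?_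
        exact mul_le_mul_of_nonneg_left (norm_le_pi_norm (u - u') i) (by positivity)
      · rw [norm_mul]
        refine (mul_le_of_le_one_left (norm_nonneg _) hm2).trans ?_
        refine (norm_le_pi_norm _ i).trans ((Matrix.linfty_opNorm_mulVec _ _).trans ?_)
        exact mul_le_mul_of_nonneg_right hΓ (norm_nonneg _)
    have e : Φ u - Φ u' = Y.mulVec (G u - G u') := by simp only [Φ, Matrix.mulVec_sub]
    rw [e]
    calc _ ≤ ‖Y‖ * ‖G u - G u'‖ := Matrix.linfty_opNorm_mulVec _ _
      _ ≤ K * ((192 * δ + ε) * ‖u - u'‖) := mul_le_mul hY hG (norm_nonneg _) hK.le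
      _ = (K * (192 * δ + ε)) * ‖u - u'‖ := by ring
      _ ≤ 1 / 2 * ‖u - u'‖ := mul_le_mul_of_nonneg_right (by nlinarith) (norm_nonneg _)
  have hΦ0 : ‖Φ 0‖ ≤ δ / 2 := by
    have hG0 : ‖G 0‖ ≤ ε := by
      refine (pi_norm_le_iff_of_nonneg hε).2 fun i => ?_
      have e : G 0 i = m ^ 2 * d i := by
        have h1 : m ^ 2 / (m + 0) = m := by
          rw [add_zero, sq, mul_div_assoc, div_self hm0, mul_one]
        simp only [G, q, Pi.zero_apply, Matrix.mulVec_zero, h1]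
        ring
      rw [e, norm_mul]
      exact (mul_le_of_le_one_left (norm_nonneg _) hm2).trans (hd i)
    calc _ ≤ ‖Y‖ * ‖G 0‖ := Matrix.linfty_opNorm_mulVec _ _
      _ ≤ K * ε := mul_le_mul hY hG0 (norm_nonneg _) hK.le
      _ ≤ δ / 2 := by linarith
  have hmaps : Set.MapsTo Φ (Metric.closedBall 0 δ) (Metric.closedBall 0 δ) := by
    intro u hu
    rw [mem_closedBall_zero_iff] at hu ⊢
    have h1 := hlip u 0 hu (by simpa using hδ.le)
    rw [sub_zero] at h1
    have h2 : ‖Φ u‖ ≤ ‖Φ u - Φ 0‖ + ‖Φ 0‖ := by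
      simpa using norm_add_le (Φ u - Φ 0) (Φ 0)
    linarith
  have hcontr : ContractingWith (1 / 2) (hmaps.restrict Φ _ _) := by
    refine ⟨by norm_num, LipschitzWith.of_dist_le_mul fun u u' => ?_⟩
    have := hlip u u' (mem_closedBall_zero_iff.1 u.2) (mem_closedBall_zero_iff.1 u'.2)
    rw [Subtype.dist_eq, Subtype.dist_eq, dist_eq_norm, dist_eq_norm]
    simpa using this
  obtain ⟨u, hu, hfix, -, -⟩ := ContractingWith.exists_fixedPoint'
    (Metric.isClosed_closedBall.isComplete) hmaps hcontr
    (Metric.mem_closedBall_self hδ.le) (edist_ne_top _ _)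
  rw [mem_closedBall_zero_iff] at hu
  refine ⟨u, fun i => (norm_le_pi_norm u i).trans hu, (hiff u).2 hfix, fun u' hu' h' => ?_⟩
  have h1 := hlip u' u ((pi_norm_le_iff_of_nonneg hδ.le).2 hu') hu
  rw [(hiff u').1 h', hfix] at h1
  have h2 : ‖u' - u‖ = 0 := by linarith [norm_nonneg (u' - u)]
  exact sub_eq_zero.1 (norm_eq_zero.1 h2)

end FixedPoint

/-! ### Entries and row sums of the variance matrices -/

section Profile

variable {N W : ℕ} {cs Cs : ℝ} {f : ZMod N → ℝ}

theorem sum_S₀_row [NeZero N] (hf : IsBandProfile N W cs Cs f) (i : ZMod N) : ∑ j, S₀ f i j = 1 := by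
  rw [← hf.sum_eq_one]
  exact Fintype.sum_equiv (Equiv.subLeft i) _ _ fun j => rfl

theorem le_S₀ [NeZero N] (hf : IsBandProfile N W cs Cs f) {i j : ZMod N} (h : cabs (i - j) ≤ W) :
    cs / W ≤ S₀ f i j := by
  have := hf.lower (i - j)
  rw [if_pos h, mul_one, ← div_eq_mul_inv] at this
  exact this

theorem S₀_le [NeZero N] (hf : IsBandProfile N W cs Cs f) (i j : ZMod N) :
    S₀ f i j ≤ if (cabs (i - j) : ℝ) ≤ Cs * W then Cs / W else 0 := by
  have := hf.upper (i - j)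
  rw [mul_ite, mul_one, mul_zero, ← div_eq_mul_inv] at this
  exact this

/-- `S₀` and its square have common mass of order one in each row. -/
theorem common_mass_le [NeZero N] (hf : IsBandProfile N W cs Cs f) (hcs : 0 < cs) (hW : 2 ≤ W) (hWN : W ≤ N)
    (i : ZMod N) :
    min (2 * cs) (cs ^ 2 / 3) / 3 ≤ ∑ j, min (2 * S₀ f i j) ((S₀ f * S₀ f) i j) := by
  have hW0 : (0 : ℝ) < W := by exact_mod_cast (by omega : 0 < W)
  -- In the window of length `w` from `i`, entries of `S₀` are at least `cs / W` and those of `S₀²`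
  -- at least `w (cs / W)²`. Both factors `1 / 3` come from `W ≤ 3 w`.
  set w := W / 2
  have hwW : (W : ℝ) ≤ 3 * w := by exact_mod_cast (by omega : W ≤ 3 * w)
  have hSS : ∀ a b, 0 ≤ (S₀ f * S₀ f) a b := fun a b =>
    Finset.sum_nonneg fun k _ => mul_nonneg (hf.nonneg _) (hf.nonneg _)
  set t := min (2 * cs) (cs ^ 2 / 3)
  have ht : 0 < t := lt_min (by positivity) (by positivity)
  have hnear : ∀ x < w, ∀ y < w, cs / W ≤ S₀ f (i + (x : ZMod N)) (i + (y : ZMod N)) :=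
    fun x hx y hy => le_S₀ hf (cabs_add_natCast_sub_le i x y (by omega) (by omega))
  have hi : ∀ x < w, cs / W ≤ S₀ f i (i + (x : ZMod N)) := fun x hx => by
    simpa using hnear 0 (by omega) x hx
  have h1 : ∑ x ∈ Finset.range w, t / W ≤
      ∑ x ∈ Finset.range w, min (2 * S₀ f i (i + x)) ((S₀ f * S₀ f) i (i + x)) := by
    refine Finset.sum_le_sum fun x hx => ?_
    have hx' := Finset.mem_range.mp hx
    refine le_min ?_ ?_
    · calc t / W ≤ 2 * cs / W := div_le_div_of_nonneg_right (min_le_left _ _) hW0.le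
        _ = 2 * (cs / W) := by ring
        _ ≤ _ := mul_le_mul_of_nonneg_left (hi x hx') zero_le_two
    · have h2 : ∑ y ∈ Finset.range w, (cs / W) * (cs / W) ≤
          ∑ y ∈ Finset.range w, S₀ f i (i + y) * S₀ f (i + y) (i + x) := by
        refine Finset.sum_le_sum fun y hy => ?_
        have hy' := Finset.mem_range.mp hy
        exact mul_le_mul (hi y hy') (hnear y hy' x hx') (by positivity) (hf.nonneg _)
      have h3 := sum_range_add_natCast_le (fun k => S₀ f i k * S₀ f k (i + x)) i (L := w)
        (by omega) Finset.univ (fun k _ => mul_nonneg (hf.nonneg _) (hf.nonneg _))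
        fun _ _ => Finset.mem_univ _
      refine le_trans ?_ (h2.trans h3)
      rw [Finset.sum_const, Finset.card_range, nsmul_eq_mul]
      calc t / W ≤ cs ^ 2 / 3 / W := div_le_div_of_nonneg_right (min_le_right _ _) hW0.le
        _ ≤ w * (cs / W * (cs / W)) := by
          rw [div_mul_div_comm, mul_div_assoc', div_le_div_iff₀ hW0 (by positivity)]
          nlinarith [mul_le_mul_of_nonneg_right hwW (show 0 ≤ cs ^ 2 * W by positivity)]
  have h4 := sum_range_add_natCast_le
    (fun j => min (2 * S₀ f i j) ((S₀ f * S₀ f) i j)) i (L := w) (by omega) Finset.univ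
    (fun j _ => le_min (mul_nonneg zero_le_two (hf.nonneg _)) (hSS _ _))
    fun _ _ => Finset.mem_univ _
  refine le_trans ?_ (h1.trans h4)
  rw [Finset.sum_const, Finset.card_range, nsmul_eq_mul, mul_div_assoc', le_div_iff₀ hW0]
  nlinarith

theorem blockSigma_comm (i j : ZMod N) : blockSigma N W i j = blockSigma N W j i := by
  simp only [blockSigma, Matrix.of_apply, and_comm, eq_comm]

theorem blockSigma_nonneg (i j : ZMod N) : 0 ≤ blockSigma N W i j := by
  simp only [blockSigma, Matrix.of_apply]
  split_ifs <;> positivity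

theorem blockSigma_le (i j : ZMod N) : blockSigma N W i j ≤ 2 / W := by
  simp only [blockSigma, Matrix.of_apply]
  split_ifs
  · norm_num
  · exact div_le_div_of_nonneg_right (by norm_num) (Nat.cast_nonneg _)
  · positivity

theorem blockSigma_eq_zero [NeZero N] {i j : ZMod N} (h : W < cabs (i - j)) : blockSigma N W i j = 0 := by
  simp only [blockSigma, Matrix.of_apply]
  refine if_neg fun hij => ?_
  obtain ⟨k, hk, rfl⟩ := Finset.mem_image.mp hij.1
  obtain ⟨l, hl, rfl⟩ := Finset.mem_image.mp hij.2
  have h1 := Finset.mem_Icc.mp hk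
  have h2 := Finset.mem_Icc.mp hl
  have := cabs_add_natCast_sub_le (0 : ZMod N) k l h1.2 h2.2
  rw [zero_add, zero_add] at this
  omega

theorem sum_blockSigma_le [NeZero N] (hW : 1 ≤ W) (i : ZMod N) : ∑ j, blockSigma N W i j ≤ 2 := by
  have hW1 : (1 : ℝ) ≤ W := by exact_mod_cast hW
  have hW0 : (0 : ℝ) < W := by linarith
  calc ∑ j, blockSigma N W i j
      ≤ ∑ j, ((if j ∈ block N W then 1 / (W : ℝ) else 0) + if i = j then 1 / (W : ℝ) else 0) := by
        refine Finset.sum_le_sum fun j _ => ?_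
        simp only [blockSigma, Matrix.of_apply]
        by_cases h1 : i ∈ block N W <;> by_cases h2 : j ∈ block N W <;> by_cases h3 : i = j <;>
          simp [h1, h2, h3, add_div]
    _ = (block N W).card * (1 / (W : ℝ)) + 1 / W := by
        rw [Finset.sum_add_distrib, ← Finset.sum_filter]
        simp
    _ ≤ W * (1 / (W : ℝ)) + 1 / W := by
        have : (block N W).card ≤ W := Finset.card_image_le.trans (by simp)
        have h2 : ((block N W).card : ℝ) ≤ W := by exact_mod_cast this
        gcongr
    _ ≤ 2 := by
        have h1 : (W : ℝ) * (1 / W) = 1 := by field_simp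
        have h2 : 1 / (W : ℝ) ≤ 1 := by rw [div_le_one hW0]; exact hW1
        linarith

theorem S_apply (ζ : ℝ) (i j : ZMod N) : S W f ζ i j = S₀ f i j - ζ * blockSigma N W i j := rfl

theorem S_comm [NeZero N] (hf : IsBandProfile N W cs Cs f) (ζ : ℝ) (i j : ZMod N) :
    S W f ζ i j = S W f ζ j i := by
  rw [S_apply, S_apply, blockSigma_comm]
  congr 1
  change f (i - j) = f (j - i)
  rw [← hf.symm, neg_sub]

theorem S_le_S₀ {ζ : ℝ} (hζ : 0 ≤ ζ) (i j : ZMod N) : S W f ζ i j ≤ S₀ f i j := by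
  rw [S_apply]
  linarith [mul_nonneg hζ (blockSigma_nonneg (W := W) i j)]

/-- Entries of `blockSigma` are at most `2 / W`, so the subtraction removes at most half of the
lower bound `cs / W`. -/
theorem le_S [NeZero N] (hf : IsBandProfile N W cs Cs f) {ζ : ℝ} (hζ : 0 ≤ ζ) (hζc : ζ ≤ cs / 4)
    {i j : ZMod N} (h : cabs (i - j) ≤ W) : cs / 2 / W ≤ S W f ζ i j := by
  have h1 := le_S₀ hf h
  have h2 := blockSigma_le (W := W) i j
  have h3 : ζ * blockSigma N W i j ≤ cs / 4 * (2 / W) :=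
    mul_le_mul hζc h2 (blockSigma_nonneg i j) (hζ.trans hζc)
  rw [S_apply]
  have e : cs / 4 * (2 / W) = cs / W - cs / 2 / W := by ring
  linarith

theorem S_nonneg [NeZero N] (hf : IsBandProfile N W cs Cs f) {ζ : ℝ} (hζ : 0 ≤ ζ) (hζc : ζ ≤ cs / 4)
    (i j : ZMod N) : 0 ≤ S W f ζ i j := by
  by_cases h : cabs (i - j) ≤ W
  · have : 0 ≤ cs := by linarith
    exact le_trans (by positivity) (le_S hf hζ hζc h)
  · rw [S_apply, blockSigma_eq_zero (not_le.1 h), mul_zero, sub_zero]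
    exact hf.nonneg _

theorem sum_S_row_le [NeZero N] (hf : IsBandProfile N W cs Cs f) {ζ : ℝ} (hζ : 0 ≤ ζ) (i : ZMod N) :
    ∑ j, S W f ζ i j ≤ 1 :=
  (Finset.sum_le_sum fun j _ => S_le_S₀ hζ i j).trans (sum_S₀_row hf i).le

end Profile

/-! ### The operator `1 - S |M|²` as a killed Laplacian -/

/-- Invertibility of `1 - S |M|²` and the max norm bound on `(1 - S |M|²)⁻¹ S`, from the identity
`Im M_i = |M_i|² (Im z_i + (S Im M)_i)`. -/
theorem oneSubSAbsMsq_bound {cs Cs y : ℝ} (hcs : 0 < cs) (hCs : 0 < Cs) (hy : 0 < y) :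
    ∃ K : ℝ, 0 < K ∧ ∀ (N : ℕ) [NeZero N] (W : ℕ) (P : Matrix (ZMod N) (ZMod N) ℝ)
      (M : ZMod N → ℂ) (t : ZMod N → ℝ) (η : ℝ), 2 ≤ W → W ≤ N → 0 < η →
      (∀ i j, P i j = P j i) → (∀ i j, 0 ≤ P i j) →
      (∀ i j, cabs (i - j) ≤ W → cs / W ≤ P i j) →
      (∀ i j, P i j ≤ if (cabs (i - j) : ℝ) ≤ Cs * W then Cs / W else 0) →
      (∀ i, ∑ j, P i j ≤ 1) → (∀ i, y ≤ (M i).im) → (∀ i, 1 / 8 ≤ ‖M i‖) → (∀ i, ‖M i‖ ≤ 2) →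
      (∀ i, 0 ≤ t i) → (∀ i ∈ block N W, η ≤ t i) →
      (∀ i, (M i).im = ‖M i‖ ^ 2 * (t i + ∑ j, P i j * (M j).im)) →
      IsUnit (oneSubSAbsMsq P M) ∧
        maxNorm ((oneSubSAbsMsq P M)⁻¹ * P) ≤ K * (1 / (W * η) + N / (W : ℝ) ^ 2) := by
  -- The conductances `v i * P i j * v j` and killing rates `v i * t i` have lower bounds `y² cs /
  -- W` and `y η`; the factor `4` comes from `v ≤ 2`.
  obtain ⟨K, hK, hgreen⟩ := green_bound (c := min (y * y * cs) y) (C := 4 * Cs)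
    (lt_min (by positivity) hy) (by positivity)
  refine ⟨128 * (K * (2 * Cs + 2)), by positivity, ?_⟩
  intro N _ W P M t η hW hWN hη hPs hP0 hPl hPu hPr hMy hM8 hM2 ht0 htb hward
  have hW0 : (0 : ℝ) < W := by exact_mod_cast (by omega : 0 < W)
  set v : ZMod N → ℝ := fun i => (M i).im
  have hv0 : ∀ i, 0 < v i := fun i => hy.trans_le (hMy i)
  have hv2 : ∀ i, v i ≤ 2 := fun i => (Complex.im_le_norm _).trans (hM2 i)
  have hM0 : ∀ i, 0 < ‖M i‖ := fun i => by linarith [hM8 i]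
  set R : ℝ := 1 / (W * η) + N / (W : ℝ) ^ 2
  have key : ∀ (x s : ZMod N → ℝ) (B B₁ : ℝ), (oneSubSAbsMsq P M).mulVec x = s →
      (∀ i, |s i| ≤ B) → ∑ i, |s i| ≤ B₁ →
      ∀ i, |x i| ≤ 128 * (K * (2 * B + 2 * B₁ * R)) := by
    intro x s B B₁ hx hs hs₁ i
    -- By `hward`, `v / ‖M‖²` is mapped to `t` by the operator. Dividing by this profile leaves only
    -- differences of `φ` and the killing term, and a further factor `v i` makes the weights
    -- symmetric.
    set φ : ZMod N → ℝ := fun i => ‖M i‖ ^ 2 * x i / v i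
    have hφv : ∀ i, ‖M i‖ ^ 2 * x i = v i * φ i := fun i => by
      simp only [φ]; have := (hv0 i).ne'; field_simp
    have hxφ : ∀ i, x i = φ i * (t i + ∑ j, P i j * v j) := fun i => by
      have h1 : ‖M i‖ ^ 2 ≠ 0 := (pow_pos (hM0 i) 2).ne'
      refine mul_left_cancel₀ h1 ?_
      rw [hφv]
      conv_lhs => rw [show v i = _ from hward i]
      ring
    have heq : ∀ i, v i * t i * φ i + ∑ j, v i * P i j * v j * (φ i - φ j) = v i * s i := by
      intro i
      have h1 : s i = x i - ∑ j, P i j * (v j * φ j) := by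
        rw [← hx, oneSubSAbsMsq, Matrix.sub_mulVec, Matrix.one_mulVec, ← Matrix.mulVec_mulVec]
        simp only [Pi.sub_apply, Matrix.mulVec, dotProduct, Matrix.diagonal_apply, ite_mul,
          zero_mul, Finset.sum_ite_eq, Finset.mem_univ, if_true, hφv]
      rw [h1, hxφ i]
      simp only [mul_sub, Finset.sum_sub_distrib, mul_add, Finset.mul_sum]
      rw [add_sub_assoc]
      refine congrArg₂ _ (by ring) (congrArg₂ _ ?_ ?_) <;>
        exact Finset.sum_congr rfl fun j _ => by ring
    have hφ := hgreen N W (fun i j => v i * P i j * v j) (fun i => v i * t i) φ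
      (fun i => v i * s i) η (2 * B) (2 * B₁) hW hWN hη
      (fun i j => by simp only [hPs i j]; ring)
      (fun i j => mul_nonneg (mul_nonneg (hv0 i).le (hP0 i j)) (hv0 j).le)
      (fun i j hij => by
        calc min (y * y * cs) y / W ≤ y * y * cs / W :=
              div_le_div_of_nonneg_right (min_le_left _ _) hW0.le
          _ = y * (cs / W) * y := by ring
          _ ≤ v i * P i j * v j := by
              have := hPl i j hij
              have h1 := hMy i
              have h2 := hMy j
              have h3 : 0 ≤ cs / W := by positivity
              exact mul_le_mul (mul_le_mul h1 this h3 (hv0 i).le) h2 hy.le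
                (mul_nonneg (hv0 i).le (hP0 i j)))
      (fun i j => by
        have h1 : v i * P i j * v j ≤ 4 * P i j := by
          have h2 : v i * v j ≤ 4 := by nlinarith [hv0 i, hv0 j, hv2 i, hv2 j]
          nlinarith [hP0 i j]
        refine h1.trans ?_
        have h3 := hPu i j
        have h4 : 0 ≤ Cs * W := by positivity
        by_cases hij : (cabs (i - j) : ℝ) ≤ Cs * W
        · rw [if_pos hij] at h3
          rw [if_pos (by linarith), mul_div_assoc]
          linarith
        · rw [if_neg hij] at h3
          refine (by linarith : 4 * P i j ≤ 0).trans ?_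
          split_ifs <;> positivity)
      (fun i => mul_nonneg (hv0 i).le (ht0 i))
      (fun i hi => (mul_le_mul_of_nonneg_right (min_le_right _ _) hη.le).trans
        (mul_le_mul (hMy i) (htb i hi) hη.le (hv0 i).le))
      heq
      (fun i => by
        rw [abs_mul, abs_of_pos (hv0 i)]
        exact mul_le_mul (hv2 i) (hs i) (abs_nonneg _) zero_le_two)
      (by
        calc ∑ i, |v i * s i| ≤ ∑ i, 2 * |s i| := Finset.sum_le_sum fun i _ => by
              rw [abs_mul, abs_of_pos (hv0 i)]
              exact mul_le_mul_of_nonneg_right (hv2 i) (abs_nonneg _)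
          _ ≤ 2 * B₁ := by rw [← Finset.mul_sum]; exact mul_le_mul_of_nonneg_left hs₁ zero_le_two)
      i
    have h1 : ‖M i‖ ^ 2 * |x i| = v i * |φ i| := by
      rw [← abs_of_pos (hv0 i), ← abs_mul, ← hφv, abs_mul, abs_of_pos (pow_pos (hM0 i) 2)]
    have h2 : 1 / 64 ≤ ‖M i‖ ^ 2 := by nlinarith [hM8 i]
    have h3 : 1 / 64 * |x i| ≤ 2 * |φ i| := by
      calc 1 / 64 * |x i| ≤ ‖M i‖ ^ 2 * |x i| := mul_le_mul_of_nonneg_right h2 (abs_nonneg _)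
        _ = v i * |φ i| := h1
        _ ≤ 2 * |φ i| := mul_le_mul_of_nonneg_right (hv2 i) (abs_nonneg _)
    linarith
  have hunit : IsUnit (oneSubSAbsMsq P M) := by
    rw [← Matrix.mulVec_injective_iff_isUnit]
    intro x x' hxx
    have h0 := key (x - x') 0 0 0 (by rw [Matrix.mulVec_sub, sub_eq_zero]; exact hxx)
      (by simp) (by simp)
    funext i
    have := h0 i
    simp only [mul_zero, zero_mul, add_zero, abs_nonpos_iff, Pi.sub_apply] at this
    exact sub_eq_zero.1 this
  refine ⟨hunit, ?_⟩
  have hdet := (Matrix.isUnit_iff_isUnit_det _).1 hunit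
  refine ciSup_le fun p => ?_
  -- A column of the product solves the equation with a column of `P` as source, of sup norm at most
  -- `Cs / W` and `ℓ¹` norm at most one.
  have h1 := key (fun i => ((oneSubSAbsMsq P M)⁻¹ * P) i p.2) (fun i => P i p.2) (Cs / W) 1
    (by
      have h2 : oneSubSAbsMsq P M * ((oneSubSAbsMsq P M)⁻¹ * P) = P :=
        Matrix.mul_nonsing_inv_cancel_left _ _ hdet
      funext i
      exact congrFun (congrFun h2 i) p.2)
    (fun i => by
      rw [abs_of_nonneg (hP0 _ _)]
      refine (hPu _ _).trans ?_
      split_ifs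
      · exact le_rfl
      · positivity)
    (by
      calc ∑ i, |P i p.2| = ∑ i, P p.2 i := Finset.sum_congr rfl fun i _ => by
            rw [abs_of_nonneg (hP0 _ _), hPs]
        _ ≤ 1 := hPr _) p.1
  refine h1.trans ?_
  have hRW : 1 / (W : ℝ) ≤ R := by
    have h2 : 1 / (W : ℝ) ≤ N / (W : ℝ) ^ 2 := by
      have : (W : ℝ) ≤ N := by exact_mod_cast hWN
      rw [div_le_div_iff₀ hW0 (by positivity)]
      nlinarith
    have h3 : 0 ≤ 1 / (W * η) := by positivity
    simp only [R]; linarith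
  have h4 : 2 * (Cs / W) + 2 * 1 * R ≤ (2 * Cs + 2) * R := by
    have : Cs / W ≤ Cs * R := by
      rw [div_eq_mul_one_div]; exact mul_le_mul_of_nonneg_left hRW hCs.le
    linarith
  calc 128 * (K * (2 * (Cs / W) + 2 * 1 * R)) ≤ 128 * (K * ((2 * Cs + 2) * R)) := by gcongr
    _ = _ := by ring

/-! ### Bounds on the inverse of `1 - M² S` -/

section Resolvent

attribute [local instance] Matrix.linftyOpNormedRing Matrix.linftyOpNormedAlgebra
  Matrix.linftyOpNormedAddCommGroup Matrix.linftyOpNormedSpace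

variable {N W : ℕ} [NeZero N] {cs Cs : ℝ} {f : ZMod N → ℝ}

/-- The `∞ → ∞` contraction property at a constant solution in the bulk. -/
theorem norm_sq_one_add_S₀_le (hf : IsBandProfile N W cs Cs f) (hcs : 0 < cs) (hW : 2 ≤ W)
    (hWN : W ≤ N) {m : ℂ} (hm : ‖m‖ ≤ 1) {a : ℝ} (ha : 0 ≤ a) (hma : a ≤ m.im ^ 2) :
    ‖(1 + m ^ 2 • (S₀ f).map Complex.ofReal) ^ 2‖ ≤
      4 - min (min (2 * cs) (cs ^ 2 / 3) / 3) 2 * (a ^ 2 / 4) := by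
  have hm2 : ‖m ^ 2‖ ≤ 1 := by rw [norm_pow]; exact pow_le_one₀ (norm_nonneg _) hm
  have hgap : a ^ 2 / 4 ≤ 2 - ‖1 + m ^ 2‖ := by
    have h1 := norm_one_add_le hm2
    have h2 : a ≤ ‖1 - m ^ 2‖ := by
      -- Both factors have imaginary part `± Im m`, so `m²` is at distance at least `(Im m)²` from
      -- `1`.
      have e : (1 : ℂ) - m ^ 2 = (1 - m) * (1 + m) := by ring
      rw [e, norm_mul]
      have h3 : |m.im| ≤ ‖1 - m‖ := by simpa using Complex.abs_im_le_norm (1 - m)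
      have h4 : |m.im| ≤ ‖1 + m‖ := by simpa using Complex.abs_im_le_norm (1 + m)
      calc a ≤ m.im ^ 2 := hma
        _ = |m.im| * |m.im| := by rw [← sq, sq_abs]
        _ ≤ _ := mul_le_mul h3 h4 (abs_nonneg _) (norm_nonneg _)
    have h5 : a ^ 2 ≤ ‖1 - m ^ 2‖ ^ 2 := pow_le_pow_left₀ ha h2 2
    linarith
  have hγ0 : 0 ≤ min (min (2 * cs) (cs ^ 2 / 3) / 3) 2 :=
    le_min (div_nonneg (le_min (by positivity) (by positivity)) (by norm_num)) (by norm_num)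
  have h := norm_sq_one_add_smul_le (P := S₀ f) (fun i j => hf.nonneg (i - j))
    (fun i => (sum_S₀_row hf i).le) hm2
    (fun i => (min_le_left _ _).trans (common_mass_le hf hcs hW hWN i)) (min_le_right _ 2)
  linarith [mul_le_mul_of_nonneg_left hgap hγ0]

theorem norm_smul_S₀_le (hf : IsBandProfile N W cs Cs f) {w : ℂ} (hw : ‖w‖ ≤ 1) :
    ‖w • (S₀ f).map Complex.ofReal‖ ≤ 1 := by
  refine linftyOpNorm_le zero_le_one fun i => ?_
  calc ∑ j, ‖(w • (S₀ f).map Complex.ofReal) i j‖ ≤ ∑ j, S₀ f i j := by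
        refine Finset.sum_le_sum fun j _ => ?_
        have h0 : 0 ≤ S₀ f i j := hf.nonneg _
        rw [Matrix.smul_apply, Matrix.map_apply, smul_eq_mul, norm_mul, Complex.norm_real,
          Real.norm_of_nonneg h0]
        exact mul_le_of_le_one_left h0 hw
    _ = 1 := sum_S₀_row hf i

theorem norm_blockSigma_le (hW : 1 ≤ W) {ζ : ℝ} (hζ : 0 ≤ ζ) :
    ‖((-ζ : ℝ) : ℂ) • (blockSigma N W).map Complex.ofReal‖ ≤ 2 * ζ := by
  refine linftyOpNorm_le (by positivity) fun i => ?_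
  calc ∑ j, ‖(((-ζ : ℝ) : ℂ) • (blockSigma N W).map Complex.ofReal) i j‖
      = ∑ j, ζ * blockSigma N W i j := by
        refine Finset.sum_congr rfl fun j _ => ?_
        rw [Matrix.smul_apply, Matrix.map_apply, smul_eq_mul, norm_mul, Complex.norm_real,
          Complex.norm_real, Real.norm_of_nonneg (blockSigma_nonneg i j), norm_neg,
          Real.norm_of_nonneg hζ]
    _ ≤ 2 * ζ := by
        rw [← Finset.mul_sum, mul_comm]
        exact mul_le_mul_of_nonneg_right (sum_blockSigma_le hW i) hζ

/-- Replacing `m²` by `M²` costs `3 δ` against the stochastic `S₀`. The block term costs `4 ζ`, from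
`|M|² ≤ 2` and row sums at most two. -/
theorem norm_diag_sq_mul_S_sub_le (hf : IsBandProfile N W cs Cs f) (hW : 1 ≤ W) {ζ δ : ℝ}
    (hζ : 0 ≤ ζ) {m : ℂ} {M : ZMod N → ℂ} (hm : ‖m‖ ≤ 1) (hδ : δ ≤ 1 / 8)
    (hM : ∀ i, ‖M i - m‖ ≤ δ) :
    ‖Matrix.diagonal M ^ 2 * (S W f ζ).map Complex.ofReal - m ^ 2 • (S₀ f).map Complex.ofReal‖ ≤
      3 * δ + 4 * ζ := by
  have hδ0 : 0 ≤ δ := (norm_nonneg _).trans (hM 0)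
  refine linftyOpNorm_le (by positivity) fun i => ?_
  have hMn : ‖M i‖ ≤ 9 / 8 := by
    have := norm_add_le (M i - m) m
    rw [sub_add_cancel] at this
    linarith [hM i]
  have h1 : ‖M i ^ 2 - m ^ 2‖ ≤ 3 * δ := by
    rw [show M i ^ 2 - m ^ 2 = (M i - m) * (M i + m) by ring, norm_mul, mul_comm]
    exact mul_le_mul ((norm_add_le _ _).trans (by linarith)) (hM i) (norm_nonneg _) (by norm_num)
  have h2 : ‖M i ^ 2‖ ≤ 2 := by
    rw [norm_pow]; nlinarith [norm_nonneg (M i)]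
  calc _ ≤ ∑ j, (3 * δ * S₀ f i j + 2 * ζ * blockSigma N W i j) := by
        refine Finset.sum_le_sum fun j _ => ?_
        have e : (Matrix.diagonal M ^ 2 * (S W f ζ).map Complex.ofReal
            - m ^ 2 • (S₀ f).map Complex.ofReal) i j =
            (M i ^ 2 - m ^ 2) * (S₀ f i j : ℂ) - M i ^ 2 * ((ζ * blockSigma N W i j : ℝ) : ℂ) := by
          rw [Matrix.sub_apply, Matrix.diagonal_pow, Matrix.diagonal_mul, Matrix.smul_apply,
            Matrix.map_apply, Matrix.map_apply, S_apply, smul_eq_mul, Pi.pow_apply]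
          push_cast; ring
        rw [e]
        refine (norm_sub_le _ _).trans ?_
        have h0 : 0 ≤ S₀ f i j := hf.nonneg _
        have h3 : 0 ≤ ζ * blockSigma N W i j := mul_nonneg hζ (blockSigma_nonneg i j)
        rw [norm_mul, norm_mul, Complex.norm_real, Complex.norm_real, Real.norm_of_nonneg h0,
          Real.norm_of_nonneg h3, mul_assoc 2 ζ]
        exact add_le_add (mul_le_mul_of_nonneg_right h1 h0) (mul_le_mul_of_nonneg_right h2 h3)
    _ ≤ 3 * δ + 4 * ζ := by
        rw [Finset.sum_add_distrib, ← Finset.mul_sum, ← Finset.mul_sum, sum_S₀_row hf]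
        nlinarith [sum_blockSigma_le (N := N) hW i]

/-- Off-diagonal decay from finite range. -/
theorem norm_apply_le_of_range {X E Y : Matrix (ZMod N) (ZMod N) ℂ} {L : ℝ} (hL : 0 ≤ L) {p : ℕ}
    (hY : Y = (1 / 2 : ℂ) • ∑ l ∈ Finset.range (2 * p), X ^ l + E)
    (hX : ∀ i j, L < (cabs (i - j) : ℝ) → X i j = 0) {i j : ZMod N}
    (hij : (2 * p : ℝ) * L < cabs (i - j)) : ‖Y i j‖ ≤ ‖E‖ := by
  have h1 : (∑ l ∈ Finset.range (2 * p), X ^ l) i j = 0 := by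
    rw [Matrix.sum_apply]
    refine Finset.sum_eq_zero fun l hl => pow_apply_eq_zero_of_range hX l i j ?_
    have : (l : ℝ) ≤ 2 * p := by exact_mod_cast (Finset.mem_range.mp hl).le
    exact (mul_le_mul_of_nonneg_right this hL).trans_lt hij
  rw [hY, Matrix.add_apply, Matrix.smul_apply, h1, smul_zero, zero_add]
  exact norm_apply_le_linftyOpNorm E i j

/-- Rounding the exponent down costs at most one factor `θ⁻¹`; the rest is `exp (-c (log x)²) = x ^
(-c log x)`. -/
theorem pow_floor_le_rpow {θ L : ℝ} (hθ : 0 < θ) (hθ1 : θ < 1) {x : ℝ} (hx : 0 < x) :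
    θ ^ ⌊Real.log x ^ 2 / (2 * L)⌋₊ ≤ θ⁻¹ * x ^ (-(-Real.log θ / (2 * L) * Real.log x)) := by
  have hl : Real.log θ < 0 := Real.log_neg hθ hθ1
  have h1 := Nat.lt_floor_add_one (Real.log x ^ 2 / (2 * L))
  have e1 : θ ^ ⌊Real.log x ^ 2 / (2 * L)⌋₊ =
      Real.exp (Real.log θ * ⌊Real.log x ^ 2 / (2 * L)⌋₊) := by
    rw [← Real.rpow_natCast, Real.rpow_def_of_pos hθ]
  have e2 : θ⁻¹ = Real.exp (-Real.log θ) := by rw [Real.exp_neg, Real.exp_log hθ]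
  rw [e1, e2, Real.rpow_def_of_pos hx, ← Real.exp_add]
  refine Real.exp_le_exp.2 ?_
  have e3 : Real.log x * -(-Real.log θ / (2 * L) * Real.log x) =
      Real.log θ * (Real.log x ^ 2 / (2 * L)) := by ring
  rw [e3]
  nlinarith

/-- All bounds on `(1 - M² S)⁻¹`. -/
theorem oneSubMsqS_bound (hf : IsBandProfile N W cs Cs f) (hCs : 0 < Cs) (hW : 1 ≤ W)
    {ζ θ : ℝ} (hζ : 0 ≤ ζ) (hζc : ζ ≤ cs / 4) {M : ZMod N → ℂ} (hM : ∀ i, ‖M i‖ ≤ 2)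
    (hθ0 : 0 < θ) (hθ : θ < 1)
    (hB : ‖Matrix.diagonal M ^ 2 * (S W f ζ).map Complex.ofReal‖ ≤ 2)
    (hsq : ‖(1 + Matrix.diagonal M ^ 2 * (S W f ζ).map Complex.ofReal) ^ 2‖ ≤ 4 * θ) :
    IsUnit (oneSubMsqS (S W f ζ) M) ∧
      (∀ i j : ZMod N, ‖(oneSubMsqS (S W f ζ) M)⁻¹ i j - (if i = j then 1 else 0)‖ ≤
        2 / (1 - θ) * (4 * Cs) * (W : ℝ)⁻¹) ∧
      (∀ i j : ZMod N, (Real.log N) ^ 2 * W < (cabs (i - j) : ℝ) →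
        ‖(oneSubMsqS (S W f ζ) M)⁻¹ i j‖ ≤ 2 / (1 - θ) * θ⁻¹ *
          (N : ℝ) ^ (-(-Real.log θ / (2 * max Cs 1) * Real.log N))) := by
  obtain ⟨Y, hYl, hYr, hYn, hexp⟩ := exists_inverse_one_sub hθ0.le hθ hB hsq
  have hBS : ∀ i j, (Matrix.diagonal M ^ 2 * (S W f ζ).map Complex.ofReal) i j =
      M i ^ 2 * (S W f ζ i j : ℂ) := fun i j => by
    rw [Matrix.diagonal_pow, Matrix.diagonal_mul, Pi.pow_apply, Matrix.map_apply]
  have hA : oneSubMsqS (S W f ζ) M = 1 - Matrix.diagonal M ^ 2 * (S W f ζ).map Complex.ofReal :=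
    rfl
  rw [hA]
  generalize Matrix.diagonal M ^ 2 * (S W f ζ).map Complex.ofReal = B at *
  have hinv : (1 - B)⁻¹ = Y := Matrix.inv_eq_left_inv hYl
  have hθ' : 0 < 1 - θ := by linarith
  have hW0 : (0 : ℝ) < W := by exact_mod_cast hW
  rw [hinv]
  refine ⟨⟨⟨1 - B, Y, hYr, hYl⟩, rfl⟩, fun i j => ?_, fun i j hij => ?_⟩
  · have hBle : ∀ i j, ‖B i j‖ ≤ 4 * Cs * (W : ℝ)⁻¹ := by
      intro i j
      have h0 := S_nonneg hf hζ hζc i j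
      have h1 : S W f ζ i j ≤ Cs * (W : ℝ)⁻¹ := by
        refine (S_le_S₀ hζ i j).trans ((S₀_le hf i j).trans ?_)
        split_ifs
        · exact (div_eq_mul_inv _ _).le
        · positivity
      rw [hBS, norm_mul, norm_pow, Complex.norm_real, Real.norm_of_nonneg h0, mul_assoc]
      refine mul_le_mul ?_ h1 h0 (by norm_num)
      nlinarith [hM i, norm_nonneg (M i)]
    -- `Y - 1 = Y B` inherits the `1 / W` size of the entries of `B`, at the price of the row norm
    -- of `Y`.
    have e : Y i j - (if i = j then 1 else 0) = (Y * B) i j := by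
      have h1 : Y * B = Y - 1 := by
        rw [mul_sub, mul_one] at hYl
        rw [← hYl]; abel
      rw [h1, Matrix.sub_apply, Matrix.one_apply]
    rw [e, mul_assoc]
    exact (norm_mul_apply_le Y B hBle i j).trans
      (mul_le_mul_of_nonneg_right hYn (by positivity))
  · have hL1 : 0 < max Cs 1 := lt_max_of_lt_left hCs
    -- Chosen so that `2 p` steps of range `max Cs 1 * W` stay within `(log N)² W`; beyond that only
    -- the tail `E` contributes. The maximum covers both the profile and the block.
    set p := ⌊Real.log N ^ 2 / (2 * max Cs 1)⌋₊
    obtain ⟨E, hE, hYE⟩ := hexp p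
    have hrange : ∀ i j, max Cs 1 * W < (cabs (i - j) : ℝ) →
        ((1 / 2 : ℂ) • (1 + B)) i j = 0 := by
      intro i j h
      have h1 : Cs * W < (cabs (i - j) : ℝ) :=
        (mul_le_mul_of_nonneg_right (le_max_left _ _) hW0.le).trans_lt h
      have h2 : (W : ℝ) < (cabs (i - j) : ℝ) := by
        refine lt_of_le_of_lt ?_ h
        exact le_mul_of_one_le_left hW0.le (le_max_right _ _)
      have hne : i ≠ j := by
        rintro rfl
        simp [cabs] at h2
        linarith
      have h3 : S W f ζ i j = 0 := by
        have h4 := S₀_le hf i j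
        rw [if_neg (not_le.2 h1)] at h4
        have h5 : S₀ f i j = 0 := le_antisymm h4 (hf.nonneg _)
        rw [S_apply, h5, blockSigma_eq_zero (by exact_mod_cast h2)]; ring
      rw [Matrix.smul_apply, Matrix.add_apply, Matrix.one_apply_ne hne, hBS, h3]
      simp
    have hp : (2 * p : ℝ) * (max Cs 1 * W) < cabs (i - j) := by
      refine lt_of_le_of_lt ?_ hij
      have h1 : (p : ℝ) ≤ Real.log N ^ 2 / (2 * max Cs 1) := Nat.floor_le (by positivity)
      rw [le_div_iff₀ (by positivity)] at h1
      rw [← mul_assoc]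
      exact mul_le_mul_of_nonneg_right (by linarith) hW0.le
    refine (norm_apply_le_of_range (by positivity) hYE hrange hp).trans (hE.trans ?_)
    have hN : (0 : ℝ) < N := by exact_mod_cast NeZero.pos N
    have h1 := pow_floor_le_rpow (L := max Cs 1) hθ0 hθ hN
    calc θ ^ p * (2 / (1 - θ)) ≤ _ := mul_le_mul_of_nonneg_right h1 (by positivity)
      _ = _ := by ring

end Resolvent

/-! ### Choice of constants and conclusion -/

/-- The theorem with a fixed smallness threshold `τ` in place of the asymptotic hypotheses. -/
theorem stability_of_small {κ cs Cs : ℝ} (hκ : 0 < κ) (hcs : 0 < cs) (hCs : 0 < Cs) :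
    ∃ δ τ C c : ℝ, 0 < δ ∧ 0 < τ ∧ 0 < C ∧ 0 < c ∧
    ∀ (N : ℕ) [NeZero N] (W : ℕ) (f : ZMod N → ℝ) (ζ : ℝ) (g : ZMod N → ℝ) (z zt : ℂ),
      2 ≤ W → W ≤ N → IsBandProfile N W cs Cs f → |zt.re| < 2 - κ → |z.re - zt.re| ≤ τ →
      0 < z.im → z.im ≤ τ → 0 ≤ ζ → ζ ≤ τ → (∀ i, |g i| ≤ τ) → 0 ≤ zt.im → zt.im ≤ z.im →
      ∃ M : ZMod N → ℂ,
        (IsSolution W f ζ g z zt M ∧ ∀ i, ‖M i - msc zt‖ ≤ δ) ∧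
        (∀ M' : ZMod N → ℂ, IsSolution W f ζ g z zt M' → (∀ i, ‖M' i - msc zt‖ ≤ δ) → M' = M) ∧
        IsUnit (oneSubMsqS (S W f ζ) M) ∧
        (∀ i j : ZMod N, ‖(oneSubMsqS (S W f ζ) M)⁻¹ i j - (if i = j then 1 else 0)‖ ≤
          C * (W : ℝ)⁻¹) ∧
        (∀ i j : ZMod N, (Real.log N) ^ 2 * W < (cabs (i - j) : ℝ) →
          ‖(oneSubMsqS (S W f ζ) M)⁻¹ i j‖ ≤ C * (N : ℝ) ^ (-(c * Real.log N))) ∧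
        IsUnit (oneSubSAbsMsq (S W f ζ) M) ∧
        maxNorm ((oneSubSAbsMsq (S W f ζ) M)⁻¹ * S W f ζ) ≤
          C * (1 / (W * z.im) + N / (W : ℝ) ^ 2) := by
  -- The gap in `‖(1 + m² S₀)²‖ ≤ 4 - σ`. Half of it is reserved for perturbation, hence `4 θ = 4 -
  -- σ / 2` and `K = 2 / (1 - θ)` below.
  set σ : ℝ := min (min (min (2 * cs) (cs ^ 2 / 3) / 3) 2 * ((κ / 32) ^ 2 / 4)) 1
  have hσ : 0 < σ := lt_min (mul_pos (lt_min (div_pos (lt_min (by positivity) (by positivity))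
    (by norm_num)) (by norm_num)) (by positivity)) one_pos
  have hσ1 : σ ≤ 1 := min_le_right _ _
  set y : ℝ := Real.sqrt (κ / 32)
  have hy : 0 < y := Real.sqrt_pos.2 (by positivity)
  set K : ℝ := 16 / σ
  have hK : 0 < K := by positivity
  -- The first two bounds serve the contraction argument, `σ / 60` preserves the gap, and `y / 2`
  -- keeps `Im M` at least `y / 2`.
  set δ : ℝ := min (min (1 / 8) (1 / (768 * K))) (min (σ / 60) (y / 2))
  have hδ : 0 < δ := by positivity
  have hδ8 : δ ≤ 1 / 8 := (min_le_left _ _).trans (min_le_left _ _)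
  have hδK : 768 * K * δ ≤ 1 := by
    have : δ ≤ 1 / (768 * K) := (min_le_left _ _).trans (min_le_right _ _)
    rw [le_div_iff₀ (by positivity)] at this
    linarith
  have hδσ : δ ≤ σ / 60 := (min_le_right _ _).trans (min_le_left _ _)
  have hδy : δ ≤ y / 2 := (min_le_right _ _).trans (min_le_right _ _)
  set τ : ℝ := min (min (δ / (20 * K)) (σ / 80)) (min (cs / 4) 1)
  have hτ : 0 < τ := by positivity
  have hτK : 4 * K * (5 * τ) ≤ δ := by
    have : τ ≤ δ / (20 * K) := (min_le_left _ _).trans (min_le_left _ _)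
    rw [le_div_iff₀ (by positivity)] at this
    linarith
  have hτσ : τ ≤ σ / 80 := (min_le_left _ _).trans (min_le_right _ _)
  have hτc : τ ≤ cs / 4 := (min_le_right _ _).trans (min_le_left _ _)
  have hτ1 : τ ≤ 1 := (min_le_right _ _).trans (min_le_right _ _)
  set θ : ℝ := 1 - σ / 8
  have hθ0 : 0 < θ := by simp only [θ]; linarith
  have hθ1 : θ < 1 := by simp only [θ]; linarith
  have hθK : 2 / (1 - θ) = K := by
    rw [show 1 - θ = σ / 8 by simp only [θ]; ring, div_div_eq_mul_div]; norm_num [K]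
  obtain ⟨K', hK', hgreen⟩ := oneSubSAbsMsq_bound (cs := cs / 2) (Cs := Cs) (y := y / 2)
    (by positivity) hCs (by positivity)
  refine ⟨δ, τ, max (max (K * (4 * Cs)) (K * θ⁻¹)) K', -Real.log θ / (2 * max Cs 1), hδ, hτ,
    lt_max_of_lt_right hK', ?_, ?_⟩
  · exact div_pos (neg_pos.2 (Real.log_neg hθ0 hθ1))
      (mul_pos two_pos (lt_max_of_lt_left hCs))
  intro N _ W f ζ g z zt hW hWN hf hre hzre hz0 hzτ hζ0 hζτ hg ht0 htz
  obtain ⟨hm1, hm4, hmpos, hmim⟩ := msc_bounds hκ hre ht0 (htz.trans (hzτ.trans hτ1))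
  have hmeq : msc zt ^ 2 + zt * msc zt + 1 = 0 := msc_equation zt
  generalize msc zt = m at *
  have hmy : y ≤ m.im := by
    rw [← Real.sqrt_sq hmpos.le]; exact Real.sqrt_le_sqrt hmim
  have hm2 : ‖m ^ 2‖ ≤ 1 := by rw [norm_pow]; exact pow_le_one₀ (norm_nonneg _) hm1
  let _ := @Matrix.linftyOpNormedRing (ZMod N) ℂ _ _ _
  have hB := norm_smul_S₀_le hf hm2
  have hsq : ‖(1 + m ^ 2 • (S₀ f).map Complex.ofReal) ^ 2‖ ≤ 4 - σ := by
    refine (norm_sq_one_add_S₀_le hf hcs hW hWN hm1 (by positivity) hmim).trans ?_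
    linarith [min_le_left (min (min (2 * cs) (cs ^ 2 / 3) / 3) 2 * ((κ / 32) ^ 2 / 4)) 1]
  obtain ⟨Y, hYl, hYr, hYn, -⟩ := exists_inverse_one_sub hθ0.le hθ1 (hB.trans one_le_two)
    (hsq.trans (by simp only [θ]; linarith))
  rw [hθK] at hYn
  set Γ : Matrix (ZMod N) (ZMod N) ℂ := ((-ζ : ℝ) : ℂ) • (blockSigma N W).map Complex.ofReal
  have hΓn := norm_blockSigma_le (N := N) (by omega : 1 ≤ W) hζ0
  -- The error of the constant `m` in the full equation. Its terms have size `2 τ`, `τ` and `2 τ`,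
  -- whence `5 * τ` in `hτK`.
  set d : ZMod N → ℂ := fun i =>
    (if i ∈ block N W then z - zt else 0) + g i + (Γ.mulVec fun _ => m) i
  have hd : ∀ i, ‖d i‖ ≤ 5 * τ := by
    intro i
    have h1 : ‖(if i ∈ block N W then z - zt else 0 : ℂ)‖ ≤ 2 * τ := by
      split_ifs
      · refine (Complex.norm_le_abs_re_add_abs_im _).trans ?_
        rw [Complex.sub_re, Complex.sub_im, abs_of_nonneg (sub_nonneg.2 htz)]
        linarith
      · rw [norm_zero]; linarith
    have h2 : ‖(g i : ℂ)‖ ≤ τ := by rw [Complex.norm_real]; exact hg i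
    have h3 : ‖(Γ.mulVec fun _ => m) i‖ ≤ 2 * τ := by
      have e : (Γ.mulVec fun _ => m) i = (∑ j, Γ i j) * m := by
        simp [Matrix.mulVec, dotProduct, Finset.sum_mul]
      rw [e, norm_mul]
      have h4 := (norm_sum_le Finset.univ fun j => Γ i j).trans (sum_norm_le_linftyOpNorm Γ i)
      exact (mul_le_of_le_one_right (norm_nonneg _) hm1).trans (h4.trans (hΓn.trans (by linarith)))
    refine (norm_add₃_le).trans ?_
    linarith
  obtain ⟨u, huδ, hueq, huniq⟩ := exists_unique_near hmeq hm1 hm4 hYl hYr hYn hK hδ hδ8 hδK hτK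
    (hΓn.trans (by linarith)) hd
  have hlow : ∀ v : ℂ, ‖v‖ ≤ δ → 1 / 8 ≤ ‖m + v‖ := by
    intro v hv
    have := norm_sub_norm_le m (-v)
    rw [sub_neg_eq_add, norm_neg] at this
    linarith
  have hsol : ∀ v : ZMod N → ℂ, (∀ i, ‖v i‖ ≤ δ) → (IsSolution W f ζ g z zt (fun i => m + v i) ↔
      ∀ i, (m + v i)⁻¹ = -zt - m - (((S₀ f).map Complex.ofReal).mulVec v) i
        - (d i + (Γ.mulVec v) i)) := by
    intro v hv
    refine forall_congr' fun i => ?_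
    have hne : m + v i ≠ 0 := norm_pos_iff.1 (by linarith [hlow _ (hv i)])
    have hS1 : (∑ j, (S₀ f i j : ℂ)) = 1 := by exact_mod_cast sum_S₀_row hf i
    have e1 : ∑ j, (S W f ζ i j : ℂ) * (m + v j) = m + (((S₀ f).map Complex.ofReal).mulVec v) i
        + ((Γ.mulVec fun _ => m) i + (Γ.mulVec v) i) := by
      have e0 : m + (((S₀ f).map Complex.ofReal).mulVec v) i =
          ∑ j, (S₀ f i j : ℂ) * m + (((S₀ f).map Complex.ofReal).mulVec v) i := by
        rw [← Finset.sum_mul, hS1, one_mul]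
      rw [e0]
      simp only [Matrix.mulVec, dotProduct, ← Finset.sum_add_distrib]
      refine Finset.sum_congr rfl fun j _ => ?_
      simp only [Γ, Matrix.smul_apply, Matrix.map_apply, S_apply, smul_eq_mul]
      push_cast
      ring
    have e2 : -(if i ∈ block N W then z else zt) - (g i : ℂ) - ∑ j, (S W f ζ i j : ℂ) * (m + v j)
        = -zt - m - (((S₀ f).map Complex.ofReal).mulVec v) i - (d i + (Γ.mulVec v) i) := by
      rw [e1]
      simp only [d]
      split_ifs <;> ring
    rw [e2]
    exact ⟨fun h => h.2, fun h => ⟨hne, h⟩⟩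
  set M : ZMod N → ℂ := fun i => m + u i
  have hMsol : IsSolution W f ζ g z zt M := (hsol u huδ).2 hueq
  have hMδ : ∀ i, ‖M i - m‖ ≤ δ := fun i => by simpa [M] using huδ i
  have hM8 : ∀ i, 1 / 8 ≤ ‖M i‖ := fun i => hlow _ (huδ i)
  have hM2 : ∀ i, ‖M i‖ ≤ 2 := fun i => (norm_add_le _ _).trans (by linarith [huδ i])
  have hζc : ζ ≤ cs / 4 := hζτ.trans hτc
  have hclose := norm_diag_sq_mul_S_sub_le hf (by omega) hζ0 hm1 hδ8 hMδ
  -- Both `3 δ` and `4 ζ` are at most `σ / 20`, and five times the sum uses up exactly `σ / 2`.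
  obtain ⟨hB', hsq'⟩ := norm_sq_one_add_le_of_close (ε := σ / 10) hB (by linarith) hsq
    (hclose.trans (by linarith))
  obtain ⟨r1, r2, r3⟩ := oneSubMsqS_bound hf hCs (by omega) hζ0 hζc hM2 hθ0 hθ1 hB'
    (hsq'.trans (by simp only [θ]; linarith))
  have hMim : ∀ i, y / 2 ≤ (M i).im := by
    intro i
    have h1 := (Complex.abs_im_le_norm (u i)).trans (huδ i)
    have h2 := (abs_le.1 h1).1
    simp only [M, Complex.add_im]
    linarith
  obtain ⟨r4, r5⟩ := hgreen N W (S W f ζ) M (fun i => if i ∈ block N W then z.im else zt.im) z.im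
    hW hWN hz0 (S_comm hf ζ) (S_nonneg hf hζ0 hζc) (fun i j => le_S hf hζ0 hζc)
    (fun i j => (S_le_S₀ hζ0 i j).trans (S₀_le hf i j)) (sum_S_row_le hf hζ0) hMim hM8 hM2
    (fun i => by split_ifs <;> linarith) (fun i hi => by rw [if_pos hi])
    -- Imaginary part of the equation, with `Im (M⁻¹) = -Im M / |M|²`.
    (fun i => by
      have h1 := congrArg Complex.im (hMsol i).2
      have h2 : Complex.normSq (M i) ≠ 0 := by
        rw [Ne, Complex.normSq_eq_zero]; exact (hMsol i).1
      rw [Complex.inv_im, div_eq_iff h2, Complex.sub_im, Complex.sub_im, Complex.neg_im,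
        Complex.ofReal_im, Complex.im_sum] at h1
      simp only [Complex.im_ofReal_mul] at h1
      rw [← Complex.normSq_eq_norm_sq]
      rw [apply_ite Complex.im] at h1
      linarith)
  have hN : (0 : ℝ) ≤ N := Nat.cast_nonneg N
  rw [hθK] at r2 r3
  refine ⟨M, ⟨hMsol, hMδ⟩, fun M' hM' hM'δ => ?_, r1, fun i j => (r2 i j).trans ?_,
    fun i j hij => (r3 i j hij).trans ?_, r4, r5.trans ?_⟩
  · have e : (fun i => m + (M' i - m)) = M' := by funext i; ring
    have h1 := huniq (fun i => M' i - m) hM'δ ((hsol (fun i => M' i - m) hM'δ).1 (by rwa [e]))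
    funext i
    have h2 : M' i - m = u i := congrFun h1 i
    exact sub_eq_iff_eq_add'.1 h2
  · exact mul_le_mul_of_nonneg_right ((le_max_left _ _).trans (le_max_left _ _)) (by positivity)
  · exact mul_le_mul_of_nonneg_right ((le_max_right _ _).trans (le_max_left _ _)) (by positivity)
  · exact mul_le_mul_of_nonneg_right (le_max_right _ _) (by positivity)

theorem eventually_rpow_neg_le {a τ : ℝ} (ha : 0 < a) (hτ : 0 < τ) :
    ∀ᶠ N : ℕ in Filter.atTop, (N : ℝ) ^ (-a) ≤ τ :=
  (((tendsto_rpow_neg_atTop ha).comp tendsto_natCast_atTop_atTop).eventually_lt_const hτ).mono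
    fun _ h => le_of_lt h

end BandMatrix

theorem lemma2p3 (κ cs Cs : ℝ) (hκ : 0 < κ) (hcs : 0 < cs) (hCs : 0 < Cs) :
    -- radius of uniqueness around `m_sc(z̃ + i0⁺)`, which pins down the solution `M`
    ∃ δ : ℝ, 0 < δ ∧
    -- `εl` is the lower-star exponent, `εu` the upper-star exponent
    ∀ εl εu : ℝ, 0 < εu → εu ≤ εl / 20 →
    ∃ C c : ℝ, ∃ N₀ : ℕ, 0 < C ∧ 0 < c ∧
    ∀ (N : ℕ) [NeZero N] (W : ℕ) (f : ZMod N → ℝ) (e ζ : ℝ) (g : ZMod N → ℝ) (z zt : ℂ),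
      N₀ ≤ N → W ≤ N →
      BandMatrix.IsBandProfile N W cs Cs f →
      |e| < 2 - κ →
      |z.re - e| ≤ (N : ℝ) ^ (-εl + 3 * εu) →
      (N : ℝ) ^ (-εl) ≤ z.im → z.im ≤ (N : ℝ) ^ (-εu) →
      0 ≤ ζ → ζ ≤ (N : ℝ) ^ (-εl + εu) →
      (∀ i, |g i| ≤ (W : ℝ) ^ (-(3 / 4) : ℝ)) →
      max (3 / 4 + εu) (1 / 2 + εl + εu) ≤ Real.logb N W →
      zt.re = e → 0 ≤ zt.im → zt.im ≤ z.im →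
      ∃ M : ZMod N → ℂ,
        (BandMatrix.IsSolution W f ζ g z zt M ∧ ∀ i, ‖M i - BandMatrix.msc zt‖ ≤ δ) ∧
        (∀ M' : ZMod N → ℂ,
          BandMatrix.IsSolution W f ζ g z zt M' → (∀ i, ‖M' i - BandMatrix.msc zt‖ ≤ δ) →
            M' = M) ∧
        IsUnit (BandMatrix.oneSubMsqS (BandMatrix.S W f ζ) M) ∧
        (∀ i j : ZMod N, (BandMatrix.cabs (i - j) : ℝ) ≤ (Real.log N) ^ 2 * W →
          ‖(BandMatrix.oneSubMsqS (BandMatrix.S W f ζ) M)⁻¹ i j - (if i = j then 1 else 0)‖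
            ≤ C * (W : ℝ)⁻¹) ∧
        (∀ i j : ZMod N, (Real.log N) ^ 2 * W < (BandMatrix.cabs (i - j) : ℝ) →
          ‖(BandMatrix.oneSubMsqS (BandMatrix.S W f ζ) M)⁻¹ i j‖
            ≤ C * (N : ℝ) ^ (-(c * Real.log N))) ∧
        IsUnit (BandMatrix.oneSubSAbsMsq (BandMatrix.S W f ζ) M) ∧
        BandMatrix.maxNorm
            ((BandMatrix.oneSubSAbsMsq (BandMatrix.S W f ζ) M)⁻¹ * BandMatrix.S W f ζ)
          ≤ C * (1 / (W * z.im) + N / (W : ℝ) ^ 2) := by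
  obtain ⟨δ, τ, C, c, hδ, hτ, hC, hc, hmain⟩ := BandMatrix.stability_of_small hκ hcs hCs
  refine ⟨δ, hδ, fun εl εu hεu hεl => ?_⟩
  obtain ⟨N₀, hN₀⟩ := Filter.eventually_atTop.1
    ((BandMatrix.eventually_rpow_neg_le hεu hτ).and
      -- `9 / 16 = (3 / 4)²`, from `W ≥ N ^ (3 / 4)` inserted in `W ^ (-3 / 4)`.
      ((BandMatrix.eventually_rpow_neg_le (a := 9 / 16) (by norm_num) hτ).and
        (Filter.eventually_ge_atTop 4)))
  refine ⟨C, c, N₀, hC, hc, ?_⟩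
  intro N _ W f e ζ g z zt hN hWN hf he hzre hzlow hzup hζ0 hζ hg hlog hzt ht0 htz
  obtain ⟨h1, h2, h4⟩ := hN₀ N hN
  have hN4 : (4 : ℝ) ≤ N := by exact_mod_cast h4
  have hN1 : (1 : ℝ) ≤ N := by linarith
  have hN0 : (0 : ℝ) < N := by linarith
  -- Covers `-εl + 3 εu` and `-εl + εu` too, because `εl ≥ 20 εu`.
  have hsmall : ∀ a : ℝ, a ≤ -εu → (N : ℝ) ^ a ≤ τ := fun a ha =>
    (Real.rpow_le_rpow_of_exponent_le hN1 ha).trans h1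
  have hlogW : 3 / 4 ≤ Real.logb N W := by linarith [(le_max_left _ _).trans hlog]
  have hW0 : (0 : ℝ) < W := by
    -- At `W = 0` the logarithm takes the default value `0 < 3 / 4`.
    rcases Nat.eq_zero_or_pos W with rfl | h
    · norm_num at hlogW
    · exact_mod_cast h
  have hNW : (N : ℝ) ^ (3 / 4 : ℝ) ≤ W := (Real.le_logb_iff_rpow_le (by linarith) hW0).1 hlogW
  have hW2 : 2 ≤ W := by
    have h5 : (4 : ℝ) ^ (1 / 2 : ℝ) = 2 := by
      rw [← Real.sqrt_eq_rpow, show (4 : ℝ) = 2 ^ 2 by norm_num, Real.sqrt_sq zero_le_two]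
    have h6 : (2 : ℝ) ≤ W := by
      calc (2 : ℝ) = 4 ^ (1 / 2 : ℝ) := h5.symm
        _ ≤ (N : ℝ) ^ (1 / 2 : ℝ) := Real.rpow_le_rpow (by norm_num) hN4 (by norm_num)
        _ ≤ (N : ℝ) ^ (3 / 4 : ℝ) := Real.rpow_le_rpow_of_exponent_le hN1 (by norm_num)
        _ ≤ W := hNW
    exact_mod_cast h6
  have hgτ : (W : ℝ) ^ (-(3 / 4) : ℝ) ≤ τ := by
    calc (W : ℝ) ^ (-(3 / 4) : ℝ) ≤ ((N : ℝ) ^ (3 / 4 : ℝ)) ^ (-(3 / 4) : ℝ) :=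
          Real.rpow_le_rpow_of_nonpos (by positivity) hNW (by norm_num)
      _ = (N : ℝ) ^ (-(9 / 16) : ℝ) := by rw [← Real.rpow_mul hN0.le]; norm_num
      _ ≤ τ := h2
  subst hzt
  obtain ⟨M, hM, hMu, r1, r2, r3, r4, r5⟩ := hmain N W f ζ g z zt hW2 hWN hf he
    (hzre.trans (hsmall _ (by linarith))) ((Real.rpow_pos_of_pos hN0 _).trans_le hzlow)
    (hzup.trans (hsmall _ le_rfl)) hζ0 (hζ.trans (hsmall _ (by linarith)))
    (fun i => (hg i).trans hgτ) ht0 htz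
  exact ⟨M, hM, hMu, r1, fun i j _ => r2 i j, r3, r4, r5⟩
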